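/- Let $d\ge1$, let $\mathcal P$ be the set of probability vectors $(p_z)_{z\in\mathbb Z^d}$ with the topology of pointwise convergence, and let $\Omega=\mathcal P^{\mathbb Z^d}$ be the space of environments $\omega=(\omega_x)_{x\in\mathbb Z^d}$, with the product topology and product $\sigma$-field. Put $\pi_{x,y}(\omega)=\omega_{x,y-x}$ and $(T_z\omega)_x=\omega_{x+z}$. For $\omega\in\Omega$ let $P_0^\omega$, with expectation $E_0^\omega$, be the law of the Markov chain $(X_n)_{n\ge0}$ on $\mathbb Z^d$ with $X_0=0$ and transition probabilities $\pi_{x,y}(\omega)$. Let $\mathbb P$, with expectation $\mathbb E$, be an i.i.d. product measure on $\Omega$ (the vectors $\omega_x$ are i.i.d.), and write $E_0=\mathbb E E_0^\omega$ and $\mathbb P_m(A)=\mathbb E\,P_0^\omega(T_{X_m}\omega\in A)$. Let $|\cdot|$ be the Euclidean norm. Assume: (N) there are $\hat u\in\mathbb Z^d\setminus\{0\}$ and $\delta>0$ with $\sum_z z\cdot\hat u\,\pi_{0,z}(\omega)\ge\delta$ for $\mathbb P$-a.e. $\omega$; (M) there are $M,s_0>0$ with $\sum_z e^{s_0|z|}\pi_{0,z}(\omega)\le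 e^{s_0M}$ for $\mathbb P$-a.e. $\omega$. Let $\mathbb P_\infty$, with expectation $\mathbb E_\infty$, be a probability measure on $\Omega$ that is a weak limit of the averages $n_j^{-1}\sum_{m=1}^{n_j}\mathbb P_m$ along some subsequence $n_j\to\infty$; such limits exist. Let $D(\omega)=E_0^\omega(X_1)$. Suppose that for some $\bar\alpha<1/2$, as $n\to\infty$, $$\mathbb E\bigl[\,|E_0^\omega(X_n)-E_0(X_n)|^2\,\bigr]=O(n^{2\bar\alpha}).$$ Then there is $\alpha<1/2$ such that, as $n\to\infty$, $$\mathbb E_\infty\bigl[\,|E_0^\omega(X_n)-n\,\mathbb E_\infty(D)|^2\,\bigr]=O(n^{2\alpha}),$$ where all the expectations in this display are of integrable quantities: $D$ and $|E_0^\omega(X_n)-n\,\mathbb E_\infty(D)|^2$ are $\mathbb P_\infty$-integrable, and $X_n$ is $P_0^\omega$-integrable for $\mathbb P_\infty$-a.e. $\omega$, for every $n$. -/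

import Mathlib

open MeasureTheory ProbabilityTheory Filter Topology
open scoped BoundedContinuousFunction

noncomputable section

namespace RWRE

/-- The lattice `ℤ^d`. -/
abbrev Site (d : ℕ) : Type := Fin d → ℤ

/-- A lattice point as a vector of Euclidean `ℝ^d`. -/
def toVec {d : ℕ} (z : Site d) : EuclideanSpace ℝ (Fin d) :=
  WithLp.toLp 2 (fun i => (z i : ℝ))

/-- The simplex of probability vectors on `ℤ^d`, with the topology of pointwise convergence and
the σ-algebra generated by the coordinates. -/
abbrev ProbVec (d : ℕ) : Type :=
  {p : Site d → ℝ // (∀ z, 0 ≤ p z) ∧ HasSum p 1}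

/-- Environments `ω = (ω_x)`, with the product topology and the product σ-algebra. -/
abbrev Env (d : ℕ) : Type := Site d → ProbVec d

/-- The transition probability `π_{x,y}(ω) = ω_{x,y-x}`. -/
def trans {d : ℕ} (ω : Env d) (x y : Site d) : ℝ := (ω x).1 (y - x)

/-- The shift `T_z`, so that `π_{x,y}(T_z ω) = π_{x+z,y+z}(ω)`. -/
def shift {d : ℕ} (z : Site d) (ω : Env d) : Env d := fun x => ω (x + z)

/-- The law of the next position of the walk in environment `ω` when it is at `x`. -/
def stepMeasure {d : ℕ} (ω : Env d) (x : Site d) : Measure (Site d) :=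
  Measure.sum fun y => ENNReal.ofReal (trans ω x y) • Measure.dirac y

lemma isProbabilityMeasure_stepMeasure {d : ℕ} (ω : Env d) (x : Site d) :
    IsProbabilityMeasure (stepMeasure ω x) := by
  constructor
  have h : HasSum (fun y => trans ω x y) 1 := by
    have := (Equiv.hasSum_iff (Equiv.subRight x) (f := (ω x).1) (a := 1)).mpr (ω x).2.2
    exact this
  have h0 : ∀ y, 0 ≤ trans ω x y := fun y => (ω x).2.1 _
  simp only [stepMeasure, Measure.sum_apply _ MeasurableSet.univ, Measure.smul_apply,
    measure_univ, smul_eq_mul, mul_one]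
  rw [← ENNReal.ofReal_tsum_of_nonneg h0 h.summable, h.tsum_eq, ENNReal.ofReal_one]

/-- The one-step transition kernel of the walk in environment `ω`, as a function of the
trajectory up to time `n`. -/
def stepKernel {d : ℕ} (ω : Env d) (n : ℕ) :
    Kernel ((i : Finset.Iic n) → Site d) (Site d) :=
  (Kernel.ofFunOfCountable (stepMeasure ω)).comap
    (fun h => h ⟨n, Finset.mem_Iic.mpr le_rfl⟩) (measurable_pi_apply _)

instance {d : ℕ} (ω : Env d) (n : ℕ) : IsMarkovKernel (stepKernel ω n) :=
  ⟨fun h => isProbabilityMeasure_stepMeasure ω (h ⟨n, Finset.mem_Iic.mpr le_rfl⟩)⟩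

/-- The quenched path measure `P_z^ω` on `(ℤ^d)^ℕ`: the law of the Markov chain with transition
probabilities `π_{x,y}(ω)` started at `z`. -/
def quenched {d : ℕ} (ω : Env d) (z : Site d) : Measure (ℕ → Site d) :=
  Kernel.traj (X := fun _ => Site d) (stepKernel ω) 0 (fun _ => z)

/-- The quenched mean `E_0^ω(X_n)`. -/
def quenchedMean {d : ℕ} (ω : Env d) (n : ℕ) : EuclideanSpace ℝ (Fin d) :=
  ∫ X, toVec (X n) ∂(quenched ω 0)

/-- The drift `D(ω) = E_0^ω(X_1)`. -/
def drift {d : ℕ} (ω : Env d) : EuclideanSpace ℝ (Fin d) := quenchedMean ω 1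

/-- The i.i.d. product environment measure with one-site marginal `μ`. -/
def envMeasure {d : ℕ} (μ : Measure (ProbVec d)) [IsProbabilityMeasure μ] : Measure (Env d) :=
  Measure.infinitePi fun _ : Site d => μ

/-- The averaged mean `E_0(X_n)`. -/
def averagedMean {d : ℕ} (P : Measure (Env d)) (n : ℕ) : EuclideanSpace ℝ (Fin d) :=
  ∫ ω, quenchedMean ω n ∂P

/-- Non-nestling in the direction `u`. -/
def NonNestling {d : ℕ} (P : Measure (Env d)) (u : Site d) : Prop :=
  ∃ δ : ℝ, 0 < δ ∧ ∀ᵐ ω ∂P, δ ≤ ∑' z : Site d, ((z ⬝ᵥ u : ℤ) : ℝ) * trans ω 0 z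

/-- The uniform exponential moment bound on the steps. -/
def ExpMoment {d : ℕ} (P : Measure (Env d)) : Prop :=
  ∃ M s₀ : ℝ, 0 < M ∧ 0 < s₀ ∧ ∀ᵐ ω ∂P,
    Summable (fun z : Site d => Real.exp (s₀ * ‖toVec z‖) * trans ω 0 z) ∧
    ∑' z : Site d, Real.exp (s₀ * ‖toVec z‖) * trans ω 0 z ≤ Real.exp (s₀ * M)

/-- `Pinf` is a limit measure of the environment process started from `P`: with
`P_m(A) = P₀(T_{X_m} ω ∈ A)`, the averages `n_j⁻¹ ∑_{m=1}^{n_j} P_m` converge weakly to the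
probability measure `Pinf` along some subsequence `(n_j)`. -/
structure IsEnvLimit {d : ℕ} (P Pinf : Measure (Env d)) : Prop where
  isProb : IsProbabilityMeasure Pinf
  tendsto : ∃ n : ℕ → ℕ, StrictMono n ∧ ∀ F : Env d →ᵇ ℝ,
    Tendsto (fun j => (n j : ℝ)⁻¹ * ∑ m ∈ Finset.Icc 1 (n j),
        ∫ ω, (∫ X, F (shift (X m) ω) ∂(quenched ω 0)) ∂P)
      atTop (𝓝 (∫ ω, F ω ∂Pinf))

end RWRE

end

open scoped ENNReal

noncomputable section

namespace RWRE

variable {d : ℕ}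

/-! Write `f_n(ω)` for the quenched mean of `X_n` and `a_n` for its average over the product
measure. Under a limit measure the mean of `f_n` is `n` times the mean drift: under `P_m` the mean
of `f_n` is `a_{m+n} - a_m`, and the Cesàro average of these increments differs from `n` times that
of the one-step increments by boundary terms of order `n² / N`. A mean minimises the quadratic
deviation, so it suffices to bound the second moment of `f_n - a_n` under the limit. On the closed
set of environments with the exponential moment bound (`tame`), `f_n` is continuous and bounded, so
a bound on this moment under `P_m`, uniform in `m`, passes to the limit.

The uniform bound compares `P_m` with the product measure through a gap of `k` steps. Replacing
`P_m` by `P_{m+k}` costs `O(k²)`, because `f_n` and its average over the position at time `k` differ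
by `O(k)` (`enorm_quenchedMean_sub_sq_le`). Non-nestling makes `exp (-s X·u)` contract at each step.
Hence, with `b` proportional to `k` and up to errors exponentially small in `k` (times powers of
`n`), three things hold: `X_{m+k}` lies more than `2b` above `X_m`; before time `m` the walk stayed
below the height of `X_m` plus `b`; and the walk started at `X_{m+k}` never drops by more than `b`
(`walk_low_le`, `tsum_hit_sub_past_le`, `tsum_hit_sub_killed_le`). The past and the future then read
the environment in disjoint half-spaces and are independent. The `k` intermediate steps are not
independent of either, but their transition probabilities are bounded by a deterministic profile of
total mass `O(k^{2d})` (`hit_le_exp`, `tsum_site_exp_le`).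

So the moment under `P_m` is at most a constant times `k^{2d} (V_n + n⁴ exp (-κ k)) + k²`, where
`V_n` is the assumed variance (`exists_variance_envLaw_le`). With `k` about `n^ε` and `ε` small, the
exponent stays below one. Limit measures exist by tightness: the moment bound confines all the `P_m`
to one compact set. -/

/-! ### Topology of the space of environments -/

instance : SecondCountableTopology (ProbVec d) :=
  IsInducing.subtypeVal.secondCountableTopology

instance : TopologicalSpace.MetrizableSpace (ProbVec d) :=
  IsEmbedding.subtypeVal.metrizableSpace

instance : BorelSpace (ProbVec d) :=
  Subtype.borelSpace {p : Site d → ℝ | (∀ z, 0 ≤ p z) ∧ HasSum p 1}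


/-! ### Averaging operators of the free and the killed walk -/

/-- The averaging operator of the walk in the environment `ω`, killed outside `S`. -/
def walk (S : Set (Site d)) (ω : Env d) (f : Site d → ℝ≥0∞) : Site d → ℝ≥0∞ :=
  S.indicator fun x => ∑' y, ENNReal.ofReal (trans ω x y) * f y

/-- The probability that the walk started at `x` stays in `S` before time `n` and is at `y`
at time `n`. -/
def hit (S : Set (Site d)) (ω : Env d) (n : ℕ) (x y : Site d) : ℝ≥0∞ :=
  (walk S ω)^[n] (Pi.single y 1) x

lemma walk_mono {S S' : Set (Site d)} (hS : S ⊆ S') (ω : Env d) {f g : Site d → ℝ≥0∞}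
    (h : f ≤ g) : walk S ω f ≤ walk S' ω g := by
  intro x
  unfold walk
  refine (Set.indicator_le_indicator_of_subset hS (fun _ => zero_le) x).trans ?_
  exact Set.indicator_le_indicator (ENNReal.tsum_le_tsum fun y => by gcongr; exact h y)

lemma walk_iterate_mono {S S' : Set (Site d)} (hS : S ⊆ S') (ω : Env d) (n : ℕ)
    {f g : Site d → ℝ≥0∞} (h : f ≤ g) : (walk S ω)^[n] f ≤ (walk S' ω)^[n] g := by
  induction n with
  | zero => exact h
  | succ n ih =>
    rw [Function.iterate_succ_apply', Function.iterate_succ_apply']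
    exact walk_mono hS ω ih

lemma walk_tsum {ι : Type*} (S : Set (Site d)) (ω : Env d) (f : ι → Site d → ℝ≥0∞) :
    walk S ω (fun x => ∑' i, f i x) = fun x => ∑' i, walk S ω (f i) x := by
  funext x
  by_cases hx : x ∈ S
  · simp only [walk, Set.indicator_of_mem hx, ← ENNReal.tsum_mul_left]
    exact ENNReal.tsum_comm
  · simp [walk, hx]

lemma walk_const_mul (S : Set (Site d)) (ω : Env d) (c : ℝ≥0∞) (f : Site d → ℝ≥0∞) :
    walk S ω (fun x => c * f x) = fun x => c * walk S ω f x := by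
  funext x
  by_cases hx : x ∈ S
  · simp only [walk, Set.indicator_of_mem hx, ← ENNReal.tsum_mul_left]
    exact tsum_congr fun y => by ring
  · simp [walk, hx]

lemma walk_iterate_eq_tsum (S : Set (Site d)) (ω : Env d) (n : ℕ) (f : Site d → ℝ≥0∞)
    (x : Site d) : (walk S ω)^[n] f x = ∑' y, hit S ω n x y * f y := by
  classical
  have key : ∀ n, (walk S ω)^[n] f =
      fun x => ∑' y, f y * (walk S ω)^[n] (Pi.single y 1) x := by
    intro n
    induction n with
    | zero =>
      funext x
      rw [tsum_eq_single x]
      · simp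
      · intro y hy
        simp [hy.symm]
    | succ n ih =>
      rw [Function.iterate_succ_apply', ih, walk_tsum]
      funext x
      refine tsum_congr fun y => ?_
      rw [walk_const_mul, Function.iterate_succ_apply']
  rw [key n]
  exact tsum_congr fun y => mul_comm _ _

lemma walk_iterate_const_mul (S : Set (Site d)) (ω : Env d) (n : ℕ) (c : ℝ≥0∞)
    (f : Site d → ℝ≥0∞) (x : Site d) :
    (walk S ω)^[n] (fun x => c * f x) x = c * (walk S ω)^[n] f x := by
  simp only [walk_iterate_eq_tsum, ← ENNReal.tsum_mul_left]
  exact tsum_congr fun y => by ring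

lemma walk_iterate_add (S : Set (Site d)) (ω : Env d) (n : ℕ)
    (f g : Site d → ℝ≥0∞) (x : Site d) :
    (walk S ω)^[n] (fun x => f x + g x) x = (walk S ω)^[n] f x + (walk S ω)^[n] g x := by
  simp only [walk_iterate_eq_tsum, ← ENNReal.tsum_add, mul_add]

lemma walk_iterate_finset_sum {ι : Type*} (s : Finset ι) (S : Set (Site d)) (ω : Env d) (n : ℕ)
    (f : ι → Site d → ℝ≥0∞) (x : Site d) :
    (walk S ω)^[n] (fun x => ∑ i ∈ s, f i x) x = ∑ i ∈ s, (walk S ω)^[n] (f i) x := by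
  simp only [walk_iterate_eq_tsum, Finset.mul_sum]
  exact Summable.tsum_finsetSum fun _ _ => ENNReal.summable

lemma walk_iterate_tsum {ι : Type*} (S : Set (Site d)) (ω : Env d) (n : ℕ)
    (f : ι → Site d → ℝ≥0∞) (x : Site d) :
    (walk S ω)^[n] (fun x => ∑' i, f i x) x = ∑' i, (walk S ω)^[n] (f i) x := by
  simp only [walk_iterate_eq_tsum, ← ENNReal.tsum_mul_left]
  exact ENNReal.tsum_comm

lemma tsum_trans (ω : Env d) (x : Site d) : ∑' y, ENNReal.ofReal (trans ω x y) = 1 := by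
  have := (isProbabilityMeasure_stepMeasure ω x).measure_univ
  simpa [stepMeasure, Measure.sum_apply _ MeasurableSet.univ] using this

lemma walk_univ_one (ω : Env d) : walk Set.univ ω 1 = 1 := by
  funext x
  simp [walk, tsum_trans]

lemma walk_iterate_one (ω : Env d) (n : ℕ) : (walk Set.univ ω)^[n] 1 = 1 :=
  Function.iterate_fixed (walk_univ_one ω) n

lemma walk_iterate_const (ω : Env d) (n : ℕ) (c : ℝ≥0∞) (x : Site d) :
    (walk Set.univ ω)^[n] (fun _ => c) x = c := by
  have := walk_iterate_const_mul Set.univ ω n c 1 x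
  simpa [walk_iterate_one] using this

lemma tsum_hit (ω : Env d) (n : ℕ) (x : Site d) : ∑' y, hit Set.univ ω n x y = 1 := by
  have := walk_iterate_eq_tsum Set.univ ω n 1 x
  simpa [walk_iterate_one] using this.symm

lemma hit_le_one (S : Set (Site d)) (ω : Env d) (n : ℕ) (x y : Site d) : hit S ω n x y ≤ 1 := by
  refine (walk_iterate_mono (Set.subset_univ S) ω n le_rfl x).trans ?_
  exact (ENNReal.le_tsum y).trans (tsum_hit ω n x).le

lemma hit_le_hit_univ (S : Set (Site d)) (ω : Env d) (n : ℕ) (x y : Site d) :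
    hit S ω n x y ≤ hit Set.univ ω n x y :=
  walk_iterate_mono (Set.subset_univ S) ω n le_rfl x

lemma hit_mul_le_walk (S : Set (Site d)) (ω : Env d) (n : ℕ) (f : Site d → ℝ≥0∞) (x y : Site d) :
    hit S ω n x y * f y ≤ (walk S ω)^[n] f x := by
  rw [walk_iterate_eq_tsum]
  exact ENNReal.le_tsum y

lemma walk_iterate_le_of_walk_le {S : Set (Site d)} {ω : Env d} {f : Site d → ℝ≥0∞} {c : ℝ≥0∞}
    (h : ∀ x, walk S ω f x ≤ c * f x) (n : ℕ) (x : Site d) :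
    (walk S ω)^[n] f x ≤ c ^ n * f x := by
  induction n generalizing x with
  | zero => simp
  | succ n ih =>
    rw [Function.iterate_succ_apply]
    refine (walk_iterate_mono le_rfl ω n (fun y => h y) x).trans ?_
    rw [walk_iterate_const_mul, pow_succ', mul_assoc]
    gcongr
    exact ih x

/-- Decomposition at the times spent outside `S`. -/
lemma walk_iterate_le_killed_add (S : Set (Site d)) (ω : Env d) (n : ℕ) (f : Site d → ℝ≥0∞)
    (x : Site d) :
    (walk Set.univ ω)^[n] f x ≤ (walk S ω)^[n] f x +
      ∑ i ∈ Finset.range n, (walk Set.univ ω)^[i]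
        (Sᶜ.indicator ((walk Set.univ ω)^[n - i] f)) x := by
  induction n generalizing x with
  | zero => simp
  | succ n ih =>
    rw [Finset.sum_range_succ']
    simp only [Function.iterate_zero, id, Nat.sub_zero, Nat.add_sub_add_right]
    by_cases hx : x ∈ S
    · have h1 : walk Set.univ ω ((walk Set.univ ω)^[n] f) x ≤
          walk Set.univ ω (fun x => (walk S ω)^[n] f x +
      ∑ i ∈ Finset.range n, (walk Set.univ ω)^[i]
        (Sᶜ.indicator ((walk Set.univ ω)^[n - i] f)) x) x := walk_mono le_rfl ω ih x
      rw [Function.iterate_succ_apply', Function.iterate_succ_apply']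
      refine h1.trans ?_
      have h2 := walk_iterate_add Set.univ ω 1 ((walk S ω)^[n] f) (fun x =>
      ∑ i ∈ Finset.range n, (walk Set.univ ω)^[i]
        (Sᶜ.indicator ((walk Set.univ ω)^[n - i] f)) x) x
      have h3 := walk_iterate_finset_sum (Finset.range n) Set.univ ω 1 (fun i =>
       (walk Set.univ ω)^[i] (Sᶜ.indicator ((walk Set.univ ω)^[n - i] f))) x
      simp only [Function.iterate_one] at h2 h3
      rw [h2, h3]
      simp only [← Function.iterate_succ_apply' (walk Set.univ ω)]
      -- Killing looks only at the site being left, so from a site of `S` the first step of the two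
      -- walks is the same.
      have h4 : walk Set.univ ω ((walk S ω)^[n] f) x = walk S ω ((walk S ω)^[n] f) x := by
        simp [walk, hx]
      rw [h4]
      gcongr
      exact le_self_add
    -- Off `S` the term `i = 0` of the sum is already the whole left side.
    · rw [Set.indicator_of_mem (by exact hx)]
      exact le_add_self.trans (le_add_of_nonneg_left zero_le)

lemma walk_shift (S : Set (Site d)) (ω : Env d) (z : Site d) (f : Site d → ℝ≥0∞) (x : Site d) :
    walk S (shift z ω) (fun y => f (y + z)) x = walk ((· - z) ⁻¹' S) ω f (x + z) := by
  unfold walk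
  have : (x + z ∈ (· - z) ⁻¹' S) ↔ x ∈ S := by simp
  by_cases hx : x ∈ S
  · rw [Set.indicator_of_mem hx, Set.indicator_of_mem (this.2 hx),
      ← (Equiv.addRight z).tsum_eq fun y => ENNReal.ofReal (trans ω (x + z) y) * f y]
    simp [trans, shift]
  · rw [Set.indicator_of_notMem hx, Set.indicator_of_notMem (this.not.2 hx)]

lemma walk_iterate_shift (S : Set (Site d)) (ω : Env d) (z : Site d) (n : ℕ)
    (f : Site d → ℝ≥0∞) (x : Site d) :
    (walk S (shift z ω))^[n] (fun y => f (y + z)) x =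
      (walk ((· - z) ⁻¹' S) ω)^[n] f (x + z) := by
  induction n generalizing f with
  | zero => rfl
  | succ n ih =>
    rw [Function.iterate_succ_apply, Function.iterate_succ_apply, ← ih]
    exact congrArg (fun g => (walk S (shift z ω))^[n] g x)
      (funext fun y => walk_shift S ω z f y)

/-- The killed walk consults the environment only at sites of `S`. The σ-algebra on the source is
left free so that it can be the one generated by the sites of `S`; this is where independence enters
later. -/
lemma measurable_walk_iterate {Ω' : Type*} [MeasurableSpace Ω'] {W : Ω' → Env d}
    {S : Set (Site d)} (hW : ∀ x ∈ S, Measurable fun o => W o x) (n : ℕ) (f : Site d → ℝ≥0∞)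
    (x : Site d) : Measurable fun o => (walk S (W o))^[n] f x := by
  induction n generalizing x with
  | zero => exact measurable_const
  | succ n ih =>
    simp only [Function.iterate_succ_apply']
    by_cases hx : x ∈ S
    · simp only [walk, Set.indicator_of_mem hx]
      refine Measurable.tsum fun y => ((?_ : Measurable _).ennreal_ofReal).mul (ih y)
      exact (measurable_pi_apply _).comp (measurable_subtype_coe.comp (hW x hx))
    · simp only [walk, Set.indicator_of_notMem hx]
      exact measurable_const

lemma measurable_hit {Ω' : Type*} [MeasurableSpace Ω'] {W : Ω' → Env d}
    {S : Set (Site d)} (hW : ∀ x ∈ S, Measurable fun o => W o x) (n : ℕ) (x y : Site d) :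
    Measurable fun o => hit S (W o) n x y :=
  measurable_walk_iterate hW n _ x

lemma measurable_shift (z : Site d) : Measurable (shift z : Env d → Env d) :=
  measurable_pi_lambda _ fun _ => measurable_pi_apply _

lemma shift_shift (y z : Site d) (ω : Env d) : shift y (shift z ω) = shift (y + z) ω := by
  funext x
  simp [shift, add_assoc]

/-! ### Time marginals of the quenched law and the Markov property -/

instance (ω : Env d) (x : Site d) : IsProbabilityMeasure (quenched ω x) := by
  unfold quenched; infer_instance

lemma lintegral_stepMeasure (ω : Env d) (f : Site d → ℝ≥0∞) (x : Site d) :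
    ∫⁻ y, f y ∂stepMeasure ω x = walk Set.univ ω f x := by
  simp [stepMeasure, lintegral_sum_measure, walk]

lemma lintegral_quenched (ω : Env d) (n : ℕ) (f : Site d → ℝ≥0∞) (x : Site d) :
    ∫⁻ X, f (X n) ∂quenched ω x = (walk Set.univ ω)^[n] f x := by
  have key : ∀ (n : ℕ) (f : Site d → ℝ≥0∞),
      ∫⁻ h, f (h ⟨n, Finset.mem_Iic.mpr le_rfl⟩)
        ∂(Kernel.partialTraj (X := fun _ => Site d) (stepKernel ω) 0 n (fun _ => x)) =
      (walk Set.univ ω)^[n] f x := by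
    intro n
    induction n with
    | zero =>
      intro f
      rw [Kernel.partialTraj_self, Kernel.id_apply, lintegral_dirac' _ (by fun_prop)]
      rfl
    | succ n ih =>
      intro f
      -- Integrating out the last step replaces `f` by its one-step average.
      rw [Kernel.partialTraj_succ_eq_comp (Nat.zero_le n),
        Kernel.lintegral_comp _ _ _ (by fun_prop),
        Function.iterate_succ_apply, ← ih]
      refine lintegral_congr fun h => ?_
      have h1 := congrArg (fun K => K h)
        (Kernel.map_partialTraj_succ_self (X := fun _ => Site d) (κ := stepKernel ω) n)
      simp only [Kernel.map_apply _ (measurable_pi_apply _)] at h1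
      have h2 := lintegral_map (μ := Kernel.partialTraj (X := fun _ => Site d) (stepKernel ω)
        n (n + 1) h) (f := f) (by fun_prop)
        (measurable_pi_apply (⟨n + 1, Finset.mem_Iic.2 le_rfl⟩ : Finset.Iic (n + 1)))
      rw [← h2, h1]
      exact lintegral_stepMeasure ω f _
  rw [← key n f, ← Kernel.traj_map_frestrictLe_apply, lintegral_map (by fun_prop) (by fun_prop)]
  rfl

/-- The law of the position at time `n` of the walk started at `x`. -/
def law (ω : Env d) (n : ℕ) (x : Site d) : Measure (Site d) :=
  (quenched ω x).map fun X => X n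

instance (ω : Env d) (n : ℕ) (x : Site d) : IsProbabilityMeasure (law ω n x) :=
  Measure.isProbabilityMeasure_map (measurable_pi_apply n).aemeasurable

lemma lintegral_law (ω : Env d) (n : ℕ) (f : Site d → ℝ≥0∞) (x : Site d) :
    ∫⁻ y, f y ∂law ω n x = (walk Set.univ ω)^[n] f x := by
  rw [law, lintegral_map (by fun_prop) (measurable_pi_apply n), lintegral_quenched]

lemma law_singleton (ω : Env d) (n : ℕ) (x y : Site d) :
    law ω n x {y} = hit Set.univ ω n x y := by
  classical
  rw [← lintegral_indicator_one (measurableSet_singleton y), lintegral_law, hit]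
  exact congrArg (fun g => (walk Set.univ ω)^[n] g x)
    (funext fun w => by simp [Set.indicator_apply, Pi.single_apply])

lemma law_zero (ω : Env d) (x : Site d) : law ω 0 x = Measure.dirac x := by
  refine Measure.ext_of_lintegral _ fun f _ => ?_
  rw [lintegral_law, lintegral_dirac]
  rfl

/-- The `n`-step transition kernel. -/
def lawKernel (ω : Env d) (n : ℕ) : Kernel (Site d) (Site d) := Kernel.ofFunOfCountable (law ω n)

lemma lawKernel_apply (ω : Env d) (n : ℕ) (x : Site d) : lawKernel ω n x = law ω n x := rfl

lemma lawKernel_comp (ω : Env d) (m n : ℕ) (x : Site d) :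
    (lawKernel ω n ∘ₖ lawKernel ω m) x = law ω (m + n) x := by
  refine Measure.ext_of_lintegral _ fun f hf => ?_
  rw [Kernel.lintegral_comp _ _ _ hf, lintegral_law, Function.iterate_add_apply]
  simp only [lawKernel_apply, lintegral_law]

lemma integral_law_add {E : Type*} [NormedAddCommGroup E] [NormedSpace ℝ E] (ω : Env d)
    (m n : ℕ) (x : Site d) {f : Site d → E} (hf : Integrable f (law ω (m + n) x)) :
    ∫ y, ∫ z, f z ∂law ω n y ∂law ω m x = ∫ z, f z ∂law ω (m + n) x := by
  rw [← lawKernel_comp] at hf ⊢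
  rw [Kernel.integral_comp hf]
  simp only [lawKernel_apply]

lemma law_shift (ω : Env d) (z : Site d) (n : ℕ) (x : Site d) :
    law (shift z ω) n x = (law ω n (x + z)).map (· - z) := by
  refine Measure.ext_of_lintegral _ fun f hf => ?_
  rw [lintegral_map hf (by fun_prop), lintegral_law, lintegral_law]
  have := walk_iterate_shift Set.univ ω z n (fun y => f (y - z)) x
  simpa using this

lemma integral_law_shift {E : Type*} [NormedAddCommGroup E] [NormedSpace ℝ E] (ω : Env d)
    (z : Site d) (n : ℕ) (f : Site d → E) :
    ∫ y, f y ∂law (shift z ω) n 0 = ∫ y, f (y - z) ∂law ω n z := by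
  rw [law_shift, show (fun w : Site d => w - z) = MeasurableEquiv.subRight z from rfl,
    (MeasurableEquiv.subRight z).measurableEmbedding.integral_map, zero_add]
  rfl

lemma toVec_sub (x y : Site d) : toVec (x - y) = toVec x - toVec y := by
  ext i; simp [toVec]

lemma toVec_add (x y : Site d) : toVec (x + y) = toVec x + toVec y := by
  ext i; simp [toVec]

lemma toVec_zero : toVec (0 : Site d) = 0 := by
  ext i; simp [toVec]

lemma quenchedMean_eq (ω : Env d) (n : ℕ) : quenchedMean ω n = ∫ y, toVec y ∂law ω n 0 := by
  rw [law, integral_map (measurable_pi_apply n).aemeasurable (by fun_prop)]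
  rfl

/-! ### Moment bounds in tame environments -/

/-- Environments with steps satisfying the exponential moment bound at every site. -/
def tame (d : ℕ) (s A : ℝ) : Set (Env d) :=
  {ω | ∀ (x : Site d) (F : Finset (Site d)),
    ∑ z ∈ F, Real.exp (s * ‖toVec z‖) * (ω x).1 z ≤ A}

/-- Each condition on a finite partial sum involves finitely many coordinates, so it is closed for
pointwise convergence; the bound on the full series then survives weak limits. -/
lemma isClosed_tame (s A : ℝ) : IsClosed (tame d s A) := by
  simp only [tame, Set.ofPred_forall]
  refine isClosed_iInter fun x => isClosed_iInter fun F => isClosed_le ?_ continuous_const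
  refine continuous_finsetSum _ fun z _ => continuous_const.mul ?_
  exact (continuous_apply z).comp (continuous_subtype_val.comp (continuous_apply x))

lemma shift_mem_tame {s A : ℝ} {ω : Env d} (h : ω ∈ tame d s A) (z : Site d) :
    shift z ω ∈ tame d s A := fun x F => h (x + z) F

lemma tame_trans_le {s A : ℝ} {ω : Env d} (h : ω ∈ tame d s A) (x z : Site d) :
    (ω x).1 z ≤ A * Real.exp (-(s * ‖toVec z‖)) := by
  have := h x {z}
  rw [Finset.sum_singleton] at this
  rw [Real.exp_neg, ← div_eq_mul_inv, le_div_iff₀ (Real.exp_pos _), mul_comm]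
  exact this

lemma walk_exp_le_of_tame {s A : ℝ} (hs : 0 ≤ s) {ω : Env d} (h : ω ∈ tame d s A)
    (w x : Site d) :
    walk Set.univ ω (fun z => ENNReal.ofReal (Real.exp (s * ‖toVec (z - w)‖))) x ≤
      ENNReal.ofReal A * ENNReal.ofReal (Real.exp (s * ‖toVec (x - w)‖)) := by
  have hA : 0 ≤ A := by simpa using h x ∅
  have h0 : ∀ z, 0 ≤ Real.exp (s * ‖toVec z‖) * (ω x).1 z := fun z =>
    mul_nonneg (Real.exp_pos _).le ((ω x).2.1 z)
  simp only [walk, Set.indicator_univ]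
  rw [← (Equiv.addRight x).tsum_eq]
  simp only [Equiv.coe_addRight, trans, add_sub_cancel_right]
  calc ∑' z, ENNReal.ofReal ((ω x).1 z) *
        ENNReal.ofReal (Real.exp (s * ‖toVec (z + x - w)‖))
      ≤ ∑' z, ENNReal.ofReal (Real.exp (s * ‖toVec z‖) * (ω x).1 z) *
        ENNReal.ofReal (Real.exp (s * ‖toVec (x - w)‖)) := by
        refine ENNReal.tsum_le_tsum fun z => ?_
        rw [← ENNReal.ofReal_mul ((ω x).2.1 z), ← ENNReal.ofReal_mul (h0 z)]
        refine ENNReal.ofReal_le_ofReal ?_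
        rw [mul_comm (Real.exp _) ((ω x).1 z), mul_assoc, ← Real.exp_add, ← mul_add]
        refine mul_le_mul_of_nonneg_left (Real.exp_le_exp.2 ?_) ((ω x).2.1 z)
        refine mul_le_mul_of_nonneg_left ?_ hs
        rw [add_sub_assoc, toVec_add]
        exact norm_add_le _ _
    _ ≤ _ := by
        rw [ENNReal.tsum_mul_right]
        gcongr
        refine ENNReal.summable.tsum_le_of_sum_le fun F => ?_
        rw [← ENNReal.ofReal_sum_of_nonneg fun z _ => h0 z]
        exact ENNReal.ofReal_le_ofReal (h x F)

lemma lintegral_law_exp_le {s A : ℝ} (hs : 0 ≤ s) {ω : Env d} (h : ω ∈ tame d s A)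
    (n : ℕ) (x : Site d) :
    ∫⁻ y, ENNReal.ofReal (Real.exp (s * ‖toVec (y - x)‖)) ∂law ω n x ≤ ENNReal.ofReal (A ^ n) := by
  have hA : 0 ≤ A := by simpa using h x ∅
  rw [lintegral_law]
  refine (walk_iterate_le_of_walk_le (walk_exp_le_of_tame hs h x) n x).trans ?_
  simp [toVec_zero, ENNReal.ofReal_pow hA]

/-- Lowering the exponential rate from `s` to `s / n` turns the bound `A ^ n` into one independent
of `n`. An elementary inequality takes the place of Jensen, at the price of a factor 2. -/
lemma lintegral_law_exp_div_le {s A : ℝ} (hs : 0 ≤ s) (hA : 1 ≤ A) {ω : Env d}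
    (h : ω ∈ tame d s A) {n : ℕ} (hn : n ≠ 0) (x : Site d) :
    ∫⁻ y, ENNReal.ofReal (Real.exp (s / n * ‖toVec (y - x)‖)) ∂law ω n x ≤
      ENNReal.ofReal (2 * A) := by
  have hA0 : 0 < A := by linarith
  -- With `Y` the left side: either `Y ≤ A`, or `Y ≤ Y (Y / A) ^ (n - 1)`.
  have key : ∀ t : ℝ, Real.exp (s / n * t) ≤ A + (A ^ n)⁻¹ * A * Real.exp (s * t) := by
    intro t
    set Y := Real.exp (s / n * t) with hY
    have hYp : 0 < Y := Real.exp_pos _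
    have hYn : Real.exp (s * t) = Y ^ n := by
      rw [hY, ← Real.exp_nat_mul]
      congr 1
      field_simp
    rw [hYn]
    rcases le_total Y A with h1 | h1
    · have : 0 ≤ (A ^ n)⁻¹ * A * Y ^ n := by positivity
      linarith
    · obtain ⟨k, rfl⟩ := Nat.exists_eq_succ_of_ne_zero hn
      have h2 : A ^ k ≤ Y ^ k := pow_le_pow_left₀ hA0.le h1 k
      have h3 : Y ≤ (A ^ (k + 1))⁻¹ * A * Y ^ (k + 1) := by
        rw [pow_succ, pow_succ, mul_inv, mul_assoc (A ^ k)⁻¹, inv_mul_cancel₀ hA0.ne', mul_one,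
          ← mul_assoc]
        refine le_mul_of_one_le_left hYp.le ?_
        rw [inv_mul_eq_div, one_le_div (by positivity)]
        exact h2
      exact h3.trans (le_add_of_nonneg_left hA0.le)
  calc ∫⁻ y, ENNReal.ofReal (Real.exp (s / n * ‖toVec (y - x)‖)) ∂law ω n x
      ≤ ∫⁻ y, (ENNReal.ofReal A + ENNReal.ofReal ((A ^ n)⁻¹ * A) *
          ENNReal.ofReal (Real.exp (s * ‖toVec (y - x)‖))) ∂law ω n x := by
        refine lintegral_mono fun y => ?_
        rw [← ENNReal.ofReal_mul (by positivity), ← ENNReal.ofReal_add hA0.le (by positivity)]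
        exact ENNReal.ofReal_le_ofReal (key _)
    _ ≤ ENNReal.ofReal A + ENNReal.ofReal ((A ^ n)⁻¹ * A) * ENNReal.ofReal (A ^ n) := by
        rw [lintegral_add_left measurable_const, lintegral_const, measure_univ, mul_one,
          lintegral_const_mul _ (by fun_prop)]
        gcongr
        exact lintegral_law_exp_le hs h n x
    _ = ENNReal.ofReal (2 * A) := by
        rw [← ENNReal.ofReal_mul (by positivity), ← ENNReal.ofReal_add hA0.le (by positivity)]
        congr 1
        field_simp
        ring

/-- The right side does not depend on `ω`. This allows the steps in the gap to be taken out of the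
expectation over environments. -/
lemma hit_le_exp {s A : ℝ} (hs : 0 ≤ s) (hA : 1 ≤ A) {ω : Env d}
    (h : ω ∈ tame d s A) {n : ℕ} (hn : n ≠ 0) (x y : Site d) :
    hit Set.univ ω n x y ≤
      ENNReal.ofReal (2 * A) * ENNReal.ofReal (Real.exp (-(s / n * ‖toVec (y - x)‖))) := by
  have h1 := lintegral_law_exp_div_le hs hA h hn x
  rw [lintegral_law] at h1
  have h2 := (hit_mul_le_walk Set.univ ω n _ x y).trans h1
  have h3 : ENNReal.ofReal (Real.exp (s / n * ‖toVec (y - x)‖)) *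
      ENNReal.ofReal (Real.exp (-(s / n * ‖toVec (y - x)‖))) = 1 := by
    rw [← ENNReal.ofReal_mul (Real.exp_pos _).le, ← Real.exp_add]
    simp
  calc _ = hit Set.univ ω n x y * ENNReal.ofReal (Real.exp (s / n * ‖toVec (y - x)‖)) *
      ENNReal.ofReal (Real.exp (-(s / n * ‖toVec (y - x)‖))) := by rw [mul_assoc, h3, mul_one]
    _ ≤ _ := by gcongr

lemma lintegral_law_enorm_le {s A : ℝ} (hs : 0 < s) (hA : 1 ≤ A) {ω : Env d}
    (h : ω ∈ tame d s A) (n : ℕ) (x : Site d) :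
    ∫⁻ y, ‖toVec (y - x)‖ₑ ∂law ω n x ≤ ENNReal.ofReal (2 * A / s * n) := by
  rcases eq_or_ne n 0 with rfl | hn
  · simp [law_zero, lintegral_dirac, toVec_zero]
  have hn' : (0 : ℝ) < n := by positivity
  calc ∫⁻ y, ‖toVec (y - x)‖ₑ ∂law ω n x
      ≤ ∫⁻ y, ENNReal.ofReal (n / s) * ENNReal.ofReal (Real.exp (s / n * ‖toVec (y - x)‖))
          ∂law ω n x := by
        refine lintegral_mono fun y => ?_
        rw [← ofReal_norm, ← ENNReal.ofReal_mul (by positivity)]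
        refine ENNReal.ofReal_le_ofReal ?_
        have := Real.add_one_le_exp (s / n * ‖toVec (y - x)‖)
        calc ‖toVec (y - x)‖ = n / s * (s / n * ‖toVec (y - x)‖) := by field_simp
          _ ≤ _ := by gcongr; linarith
    _ ≤ ENNReal.ofReal (n / s) * ENNReal.ofReal (2 * A) := by
        rw [lintegral_const_mul _ (by fun_prop)]
        gcongr
        exact lintegral_law_exp_div_le hs.le hA h hn x
    _ = _ := by
        rw [← ENNReal.ofReal_mul (by positivity)]
        congr 1
        ring

lemma lintegral_law_enorm_sq_le {s A : ℝ} (hs : 0 < s) (hA : 1 ≤ A) {ω : Env d}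
    (h : ω ∈ tame d s A) (n : ℕ) (x : Site d) :
    ∫⁻ y, ‖toVec (y - x)‖ₑ ^ 2 ∂law ω n x ≤ ENNReal.ofReal (4 * A / s ^ 2 * n ^ 2) := by
  rcases eq_or_ne n 0 with rfl | hn
  · simp [law_zero, lintegral_dirac, toVec_zero]
  have hn' : (0 : ℝ) < n := by positivity
  calc ∫⁻ y, ‖toVec (y - x)‖ₑ ^ 2 ∂law ω n x
      ≤ ∫⁻ y, ENNReal.ofReal (2 * (n / s) ^ 2) *
          ENNReal.ofReal (Real.exp (s / n * ‖toVec (y - x)‖)) ∂law ω n x := by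
        refine lintegral_mono fun y => ?_
        rw [← ofReal_norm, ← ENNReal.ofReal_mul (by positivity),
          ← ENNReal.ofReal_pow (norm_nonneg _)]
        refine ENNReal.ofReal_le_ofReal ?_
        have := Real.pow_div_factorial_le_exp (s / n * ‖toVec (y - x)‖) (by positivity) 2
        calc ‖toVec (y - x)‖ ^ 2
            = 2 * (n / s) ^ 2 * ((s / n * ‖toVec (y - x)‖) ^ 2 / (Nat.factorial 2 : ℕ)) := by
              simp only [Nat.factorial]
              field_simp
              norm_num
          _ ≤ _ := by gcongr
    _ ≤ ENNReal.ofReal (2 * (n / s) ^ 2) * ENNReal.ofReal (2 * A) := by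
        rw [lintegral_const_mul _ (by fun_prop)]
        gcongr
        exact lintegral_law_exp_div_le hs.le hA h hn x
    _ = _ := by
        rw [← ENNReal.ofReal_mul (by positivity)]
        congr 1
        ring

lemma integrable_toVec_sub {s A : ℝ} (hs : 0 < s) (hA : 1 ≤ A) {ω : Env d}
    (h : ω ∈ tame d s A) (n : ℕ) (x w : Site d) :
    Integrable (fun y => toVec (y - w)) (law ω n x) := by
  have h1 : Integrable (fun y => toVec (y - x)) (law ω n x) := by
    refine ⟨by fun_prop, ?_⟩
    exact (lintegral_law_enorm_le hs hA h n x).trans_lt ENNReal.ofReal_lt_top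
  have h2 := h1.add (integrable_const (toVec (x - w)))
  refine h2.congr (Eventually.of_forall fun y => ?_)
  simp only [Pi.add_apply, ← toVec_add]
  congr 1
  abel

lemma integrable_toVec {s A : ℝ} (hs : 0 < s) (hA : 1 ≤ A) {ω : Env d}
    (h : ω ∈ tame d s A) (n : ℕ) (x : Site d) :
    Integrable toVec (law ω n x) := by
  simpa using integrable_toVec_sub hs hA h n x 0

lemma integrable_toVec_quenched {s A : ℝ} (hs : 0 < s) (hA : 1 ≤ A) {ω : Env d}
    (h : ω ∈ tame d s A) (n : ℕ) (x : Site d) :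
    Integrable (fun X : ℕ → Site d => toVec (X n)) (quenched ω x) := by
  have := integrable_toVec hs hA h n x
  exact (integrable_map_measure (f := fun X : ℕ → Site d => X n) (by fun_prop)
    (measurable_pi_apply n).aemeasurable).1 this

lemma norm_quenchedMean_le {s A : ℝ} (hs : 0 < s) (hA : 1 ≤ A) {ω : Env d}
    (h : ω ∈ tame d s A) (n : ℕ) : ‖quenchedMean ω n‖ ≤ 2 * A / s * n := by
  have h1 := lintegral_law_enorm_le hs hA h n 0
  simp only [sub_zero] at h1
  have h2 := (enorm_integral_le_lintegral_enorm (μ := law ω n 0) toVec).trans h1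
  rw [← quenchedMean_eq, ← ofReal_norm] at h2
  exact (ENNReal.ofReal_le_ofReal_iff (by positivity)).1 h2

lemma quenchedMean_shift {s A : ℝ} (hs : 0 < s) (hA : 1 ≤ A) {ω : Env d}
    (h : ω ∈ tame d s A) (n : ℕ) (z : Site d) :
    quenchedMean (shift z ω) n = ∫ y, toVec y ∂law ω n z - toVec z := by
  rw [quenchedMean_eq, integral_law_shift]
  simp only [toVec_sub]
  rw [integral_sub (integrable_toVec hs hA h n z) (integrable_const _)]
  simp

lemma integrable_quenchedMean_shift {s A : ℝ} (hs : 0 < s) (hA : 1 ≤ A) {ω : Env d}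
    (h : ω ∈ tame d s A) (m n : ℕ) (x : Site d) :
    Integrable (fun y => quenchedMean (shift y ω) n) (law ω m x) :=
  Integrable.of_bound StronglyMeasurable.of_discrete.aestronglyMeasurable
    (2 * A / s * n) <| Eventually.of_forall fun y =>
    norm_quenchedMean_le hs hA (shift_mem_tame h y) n

/-- The Markov property for the quenched mean. -/
lemma quenchedMean_add {s A : ℝ} (hs : 0 < s) (hA : 1 ≤ A) {ω : Env d}
    (h : ω ∈ tame d s A) (m n : ℕ) :
    quenchedMean ω (m + n) =
      quenchedMean ω m + ∫ y, quenchedMean (shift y ω) n ∂law ω m 0 := by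
  rw [quenchedMean_eq, ← integral_law_add ω m n 0 (integrable_toVec hs hA h _ _),
    quenchedMean_eq, ← integral_add (integrable_toVec hs hA h _ _)
      (integrable_quenchedMean_shift hs hA h _ _ _)]
  refine integral_congr_ae (Eventually.of_forall fun y => ?_)
  simp only
  rw [quenchedMean_shift hs hA h]
  abel

lemma measurable_law (n : ℕ) (x : Site d) : Measurable fun ω : Env d => law ω n x := by
  refine Measure.measurable_of_measurable_coe _ fun s hs => ?_
  have : ∀ ω : Env d, law ω n x s = (walk Set.univ ω)^[n] (s.indicator 1) x := fun ω => by
    rw [← lintegral_law, lintegral_indicator_one hs]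
  simp only [this]
  exact measurable_walk_iterate (fun y _ => measurable_pi_apply y) n _ x

lemma measurable_quenchedMean (n : ℕ) : Measurable fun ω : Env d => quenchedMean ω n := by
  let κ : Kernel (Env d) (Site d) := ⟨fun ω => law ω n 0, measurable_law n 0⟩
  have h : StronglyMeasurable fun ω : Env d => ∫ y, toVec y ∂κ ω :=
    StronglyMeasurable.integral_kernel StronglyMeasurable.of_discrete
  exact (funext fun ω => quenchedMean_eq ω n) ▸ h.measurable

lemma integral_law_one {E : Type*} [NormedAddCommGroup E] [NormedSpace ℝ E] [CompleteSpace E]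
    (ω : Env d) {f : Site d → E} (hf : Integrable f (law ω 1 0)) :
    ∫ y, f y ∂law ω 1 0 = ∑' y, (ω 0).1 y • f y := by
  rw [integral_countable hf]
  refine tsum_congr fun y => ?_
  congr 1
  rw [measureReal_def, law_singleton, hit]
  simp only [Function.iterate_one, walk, Set.indicator_univ]
  rw [tsum_eq_single y]
  · simp [trans, (ω 0).2.1 y]
  · intro z hz
    simp [hz]

/-! ### Lattice sums of exponentials -/

/-- `∑_z f z` over the lattice of a product of functions of the coordinates. -/
lemma tsum_prod_site (d : ℕ) (f : ℤ → ℝ≥0∞) :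
    ∑' z : Site d, ∏ i, f (z i) = (∑' t, f t) ^ d := by
  induction d with
  | zero => simp [tsum_fintype]
  | succ d ih =>
    rw [← (Fin.consEquiv fun _ : Fin (d + 1) => ℤ).tsum_eq, ENNReal.tsum_prod']
    simp only [Fin.consEquiv, Equiv.coe_fn_mk, Fin.prod_univ_succ, Fin.cons_zero, Fin.cons_succ]
    simp only [ENNReal.tsum_mul_left, ENNReal.tsum_mul_right]
    rw [pow_succ', ← ih]

/-- Away from `0` the bound `exp (-x) ≤ 2 / x²` reduces the sum to that of `1 / t²`. The true order
is `k`; any power of `k` would do. -/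
lemma tsum_int_exp_le {c : ℝ} (hc : 0 < c) :
    ∃ C : ℝ, 0 ≤ C ∧ ∀ k : ℕ, k ≠ 0 →
      ∑' t : ℤ, ENNReal.ofReal (Real.exp (-(c / k * |(t : ℝ)|))) ≤ ENNReal.ofReal (C * k ^ 2) := by
  have hsum : Summable fun t : ℤ => 1 / (t : ℝ) ^ 2 := Real.summable_one_div_int_pow.2 one_lt_two
  refine ⟨1 + 2 / c ^ 2 * ∑' t : ℤ, 1 / (t : ℝ) ^ 2, by positivity, fun k hk => ?_⟩
  have hk1 : (1 : ℝ) ≤ k := by exact_mod_cast Nat.one_le_iff_ne_zero.2 hk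
  have hk0 : (0 : ℝ) < k := by positivity
  have hs1 : Summable fun t : ℤ => if t = 0 then (1 : ℝ) else 0 :=
    (hasSum_ite_eq (0 : ℤ) (1 : ℝ)).summable
  have hsum2 : Summable fun t : ℤ =>
      (if t = 0 then (1 : ℝ) else 0) + 2 * k ^ 2 / c ^ 2 * (1 / (t : ℝ) ^ 2) :=
    hs1.add (hsum.mul_left _)
  have h0 : ∀ t : ℤ,
      0 ≤ (if t = 0 then (1 : ℝ) else 0) + 2 * k ^ 2 / c ^ 2 * (1 / (t : ℝ) ^ 2) := by
    intro t
    split_ifs <;> positivity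
  calc ∑' t : ℤ, ENNReal.ofReal (Real.exp (-(c / k * |(t : ℝ)|)))
      ≤ ∑' t : ℤ, ENNReal.ofReal
          ((if t = 0 then (1 : ℝ) else 0) + 2 * k ^ 2 / c ^ 2 * (1 / (t : ℝ) ^ 2)) := by
        refine ENNReal.tsum_le_tsum fun t => ENNReal.ofReal_le_ofReal ?_
        by_cases ht : t = 0
        · simp [ht]
        · have ht' : 0 < |(t : ℝ)| := by positivity
          rw [if_neg ht, zero_add, Real.exp_neg, inv_le_comm₀ (Real.exp_pos _) (by positivity)]
          have := Real.pow_div_factorial_le_exp (c / k * |(t : ℝ)|) (by positivity) 2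
          refine le_trans (le_of_eq ?_) this
          rw [← sq_abs (t : ℝ)]
          simp only [Nat.factorial]
          field_simp
          norm_num
    _ = ENNReal.ofReal (∑' t : ℤ,
          ((if t = 0 then (1 : ℝ) else 0) + 2 * k ^ 2 / c ^ 2 * (1 / (t : ℝ) ^ 2))) :=
        (ENNReal.ofReal_tsum_of_nonneg h0 hsum2).symm
    _ ≤ _ := by
        refine ENNReal.ofReal_le_ofReal ?_
        rw [hs1.tsum_add (hsum.mul_left _), tsum_mul_left, tsum_ite_eq, add_mul]
        have : (1 : ℝ) ≤ 1 * k ^ 2 := by rw [one_mul]; exact one_le_pow₀ hk1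
        refine add_le_add this (le_of_eq ?_)
        ring

lemma abs_apply_le_norm_toVec (z : Site d) (i : Fin d) : |(z i : ℝ)| ≤ ‖toVec z‖ := by
  have := PiLp.norm_apply_le (toVec z) i
  simpa [toVec] using this

lemma tsum_site_exp_le (hd : d ≠ 0) {c : ℝ} (hc : 0 < c) :
    ∃ C : ℝ, 0 ≤ C ∧ ∀ k : ℕ, k ≠ 0 →
      ∑' z : Site d, ENNReal.ofReal (Real.exp (-(c / k * ‖toVec z‖))) ≤
        ENNReal.ofReal (C * k ^ (2 * d)) := by
  have hd' : (0 : ℝ) < d := by positivity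
  obtain ⟨C, hC, h⟩ := tsum_int_exp_le (c := c / d) (by positivity)
  refine ⟨C ^ d, by positivity, fun k hk => ?_⟩
  have hk0 : (0 : ℝ) < k := by positivity
  calc ∑' z : Site d, ENNReal.ofReal (Real.exp (-(c / k * ‖toVec z‖)))
      ≤ ∑' z : Site d, ∏ i, ENNReal.ofReal (Real.exp (-(c / d / k * |(z i : ℝ)|))) := by
        refine ENNReal.tsum_le_tsum fun z => ?_
        rw [← ENNReal.ofReal_prod_of_nonneg fun i _ => (Real.exp_pos _).le, ← Real.exp_sum]
        refine ENNReal.ofReal_le_ofReal (Real.exp_le_exp.2 ?_)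
        rw [Finset.sum_neg_distrib, ← Finset.mul_sum]
        have : ∑ i, |(z i : ℝ)| ≤ d * ‖toVec z‖ := by
          refine (Finset.sum_le_sum fun i _ => abs_apply_le_norm_toVec z i).trans ?_
          simp
        refine neg_le_neg ?_
        calc c / d / k * ∑ i, |(z i : ℝ)| ≤ c / d / k * (d * ‖toVec z‖) := by gcongr
          _ = _ := by field_simp
    _ = (∑' t : ℤ, ENNReal.ofReal (Real.exp (-(c / d / k * |(t : ℝ)|)))) ^ d :=
        tsum_prod_site d fun t => ENNReal.ofReal (Real.exp (-(c / d / k * |(t : ℝ)|)))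
    _ ≤ ENNReal.ofReal (C * k ^ 2) ^ d := by gcongr; exact h k hk
    _ = _ := by
        rw [← ENNReal.ofReal_pow (by positivity), mul_pow, ← pow_mul]

lemma summable_exp_neg_norm (hd : d ≠ 0) {c : ℝ} (hc : 0 < c) :
    Summable fun z : Site d => Real.exp (-(c * ‖toVec z‖)) := by
  obtain ⟨C, -, h⟩ := tsum_site_exp_le hd hc
  have h1 := (h 1 one_ne_zero).trans_lt ENNReal.ofReal_lt_top
  have h2 := ENNReal.summable_toReal h1.ne
  refine h2.congr fun z => ?_
  rw [ENNReal.toReal_ofReal (Real.exp_pos _).le]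
  simp

/-! ### Continuity of the quenched mean -/

lemma continuous_shift (z : Site d) : Continuous (shift z : Env d → Env d) :=
  continuous_pi fun _ => continuous_apply _

lemma summable_exp_mul_norm_add (hd : d ≠ 0) {s : ℝ} (hs : 0 < s) (B : ℝ) :
    Summable fun z : Site d => Real.exp (-(s * ‖toVec z‖)) * (‖toVec z‖ + B) := by
  have h1 := ((summable_exp_neg_norm hd (half_pos hs)).mul_left (2 / s)).add
    ((summable_exp_neg_norm hd hs).mul_right |B|)
  refine Summable.of_norm_bounded h1 fun z => ?_
  rw [norm_mul, Real.norm_of_nonneg (Real.exp_pos _).le]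
  have h2 : ‖‖toVec z‖ + B‖ ≤ ‖toVec z‖ + |B| := by
    refine (norm_add_le _ _).trans ?_
    simp
  have h3 : ‖toVec z‖ ≤ 2 / s * Real.exp (s / 2 * ‖toVec z‖) := by
    have := Real.add_one_le_exp (s / 2 * ‖toVec z‖)
    calc ‖toVec z‖ = 2 / s * (s / 2 * ‖toVec z‖) := by field_simp
      _ ≤ _ := by gcongr; linarith
  calc Real.exp (-(s * ‖toVec z‖)) * ‖‖toVec z‖ + B‖
      ≤ Real.exp (-(s * ‖toVec z‖)) * (2 / s * Real.exp (s / 2 * ‖toVec z‖) + |B|) := by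
        gcongr; linarith
    _ = _ := by
        rw [mul_add, mul_left_comm, ← Real.exp_add]
        congr 4
        ring

/-- On the closed set of tame environments the quenched mean is continuous. -/
lemma continuousOn_quenchedMean (hd : d ≠ 0) {s A : ℝ} (hs : 0 < s) (hA : 1 ≤ A) (n : ℕ) :
    ContinuousOn (fun ω : Env d => quenchedMean ω n) (tame d s A) := by
  induction n with
  | zero =>
    have h0 : ContinuousOn (fun _ : Env d => (0 : EuclideanSpace ℝ (Fin d))) (tame d s A) :=
      continuousOn_const
    refine h0.congr fun ω _ => ?_
    simp only [quenchedMean_eq, law_zero, integral_dirac, toVec_zero]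
  | succ n ih =>
    -- Decomposition at the first step. On tame environments the series is dominated termwise by a
    -- summable sequence independent of `ω`, so continuity passes to the sum.
    have h1 : ∀ ω ∈ tame d s A, quenchedMean ω (n + 1) =
        ∑' y, (ω 0).1 y • (toVec y + quenchedMean (shift y ω) n) := by
      intro ω hω
      have hi := (integrable_toVec hs hA hω 1 0).add (integrable_quenchedMean_shift hs hA hω 1 n 0)
      rw [add_comm n 1, quenchedMean_add hs hA hω, quenchedMean_eq,
        ← integral_add (integrable_toVec hs hA hω _ _)
          (integrable_quenchedMean_shift hs hA hω _ _ _)]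
      exact integral_law_one ω hi
    refine ContinuousOn.congr ?_ h1
    refine continuousOn_tsum (u := fun y =>
      A * (Real.exp (-(s * ‖toVec y‖)) * (‖toVec y‖ + 2 * A / s * n))) (fun y => ?_)
      ((summable_exp_mul_norm_add hd hs _).mul_left A) ?_
    · have h2 : Continuous fun ω : Env d => (ω 0).1 y :=
        (continuous_apply y).comp (continuous_subtype_val.comp (continuous_apply 0))
      have h3 : ContinuousOn (fun _ : Env d => toVec y) (tame d s A) := continuousOn_const
      refine h2.continuousOn.smul (h3.add ?_)
      exact ih.comp (continuous_shift y).continuousOn fun ω hω => shift_mem_tame hω y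
    · intro y ω hω
      rw [norm_smul, Real.norm_of_nonneg ((ω 0).2.1 y), ← mul_assoc]
      have h2 := norm_quenchedMean_le hs hA (shift_mem_tame hω y) n
      refine mul_le_mul (tame_trans_le hω 0 y) ((norm_add_le _ _).trans (by gcongr))
        (norm_nonneg _) (by positivity)

/-! ### The environment seen from the walker -/

lemma measurable_map_shift_law (m : ℕ) :
    Measurable fun ω : Env d => (law ω m 0).map fun x => shift x ω := by
  refine Measure.measurable_of_measurable_coe _ fun s hs => ?_
  have : ∀ ω : Env d, ((law ω m 0).map fun x => shift x ω) s =
      ∑' x, hit Set.univ ω m 0 x * s.indicator 1 (shift x ω) := fun ω => by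
    rw [← lintegral_indicator_one hs, lintegral_map (measurable_one.indicator hs) (by fun_prop),
      lintegral_law, walk_iterate_eq_tsum]
  simp only [this]
  refine Measurable.tsum fun x => ?_
  exact (measurable_hit (fun y _ => measurable_pi_apply y) m 0 x).mul
    ((measurable_one.indicator hs).comp (measurable_shift x))

/-- The kernel of the environment seen from the walker at time `m`. -/
def envKernel (d m : ℕ) : Kernel (Env d) (Env d) :=
  ⟨fun ω => (law ω m 0).map fun x => shift x ω, measurable_map_shift_law m⟩

instance (m : ℕ) : IsMarkovKernel (envKernel d m) :=
  ⟨fun _ => Measure.isProbabilityMeasure_map (Measurable.of_discrete.aemeasurable)⟩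

lemma lintegral_envKernel (m : ℕ) (ω : Env d) {f : Env d → ℝ≥0∞} (hf : Measurable f) :
    ∫⁻ ω', f ω' ∂envKernel d m ω = ∫⁻ x, f (shift x ω) ∂law ω m 0 :=
  lintegral_map hf Measurable.of_discrete

lemma integral_envKernel {E : Type*} [NormedAddCommGroup E] [NormedSpace ℝ E] (m : ℕ) (ω : Env d)
    {f : Env d → E} (hf : StronglyMeasurable f) :
    ∫ ω', f ω' ∂envKernel d m ω = ∫ x, f (shift x ω) ∂law ω m 0 :=
  integral_map Measurable.of_discrete.aemeasurable hf.aestronglyMeasurable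

/-- The law `P_m` of the environment seen from the walker at time `m`. -/
def envLaw (P : Measure (Env d)) (m : ℕ) : Measure (Env d) := P.bind (envKernel d m)

instance (P : Measure (Env d)) [IsProbabilityMeasure P] (m : ℕ) :
    IsProbabilityMeasure (envLaw P m) := by
  unfold envLaw; infer_instance

lemma lintegral_envLaw (P : Measure (Env d)) (m : ℕ) {f : Env d → ℝ≥0∞} (hf : Measurable f) :
    ∫⁻ ω, f ω ∂envLaw P m = ∫⁻ ω, ∫⁻ x, f (shift x ω) ∂law ω m 0 ∂P := by
  rw [envLaw, Measure.lintegral_bind (Kernel.aemeasurable _) hf.aemeasurable]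
  simp only [lintegral_envKernel _ _ hf]

lemma integral_envLaw {E : Type*} [NormedAddCommGroup E] [NormedSpace ℝ E]
    (P : Measure (Env d)) [IsProbabilityMeasure P] (m : ℕ) {f : Env d → E}
    (hf : StronglyMeasurable f) (hfi : Integrable f (envLaw P m)) :
    ∫ ω, f ω ∂envLaw P m = ∫ ω, ∫ x, f (shift x ω) ∂law ω m 0 ∂P := by
  rw [envLaw, Measure.comp_eq_comp_const_apply] at hfi ⊢
  rw [Kernel.integral_comp hfi]
  simp only [Kernel.const_apply, integral_envKernel _ _ hf]

/-- The environment seen from the walker is itself a Markov chain: walking `n` more steps in the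
shifted environment continues the original walk. -/
lemma lintegral_envLaw_add (P : Measure (Env d)) (m n : ℕ) {f : Env d → ℝ≥0∞}
    (hf : Measurable f) :
    ∫⁻ ω, f ω ∂envLaw P (m + n) = ∫⁻ ω, ∫⁻ x, f (shift x ω) ∂law ω n 0 ∂envLaw P m := by
  have h1 : Measurable fun ω : Env d => ∫⁻ x, f (shift x ω) ∂law ω n 0 := by
    simp only [← lintegral_envKernel n _ hf]
    exact hf.lintegral_kernel
  rw [lintegral_envLaw _ _ hf, lintegral_envLaw _ _ h1]
  refine lintegral_congr fun ω => ?_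
  rw [lintegral_law, lintegral_law, Function.iterate_add_apply]
  refine congrArg (fun g => (walk Set.univ ω)^[m] g 0) (funext fun x => ?_)
  rw [lintegral_law]
  simp only [shift_shift]
  have := walk_iterate_shift Set.univ ω x n (fun y => f (shift y ω)) 0
  rw [this]
  simp

lemma ae_envLaw_mem {P : Measure (Env d)} {G : Set (Env d)} (hG : MeasurableSet G)
    (hs : ∀ ω ∈ G, ∀ z, shift z ω ∈ G) (h : ∀ᵐ ω ∂P, ω ∈ G) (m : ℕ) :
    ∀ᵐ ω ∂envLaw P m, ω ∈ G := by
  rw [ae_iff, ← Set.compl_def, ← lintegral_indicator_one hG.compl,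
    lintegral_envLaw _ _ (measurable_one.indicator hG.compl)]
  rw [lintegral_eq_zero_iff']
  · filter_upwards [h] with ω hω
    simp [hs ω hω]
  · simp only [← lintegral_envKernel m _ (measurable_one.indicator hG.compl)]
    exact ((measurable_one.indicator hG.compl).lintegral_kernel).aemeasurable

/-- The Cesàro average of `P_1, …, P_N`. -/
def avgLaw (P : Measure (Env d)) (N : ℕ) : Measure (Env d) :=
  (N : ℝ≥0∞)⁻¹ • ∑ m ∈ Finset.Icc 1 N, envLaw P m

lemma isProbabilityMeasure_avgLaw (P : Measure (Env d)) [IsProbabilityMeasure P] {N : ℕ}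
    (hN : N ≠ 0) : IsProbabilityMeasure (avgLaw P N) := by
  constructor
  simp only [avgLaw, Measure.smul_apply, Measure.finsetSum_apply, measure_univ, smul_eq_mul]
  simp only [Finset.sum_const, Nat.card_Icc, Nat.add_sub_cancel, nsmul_eq_mul, mul_one]
  exact ENNReal.inv_mul_cancel (by exact_mod_cast hN) (by simp)

lemma ae_avgLaw_mem {P : Measure (Env d)} {G : Set (Env d)} (hG : MeasurableSet G)
    (hs : ∀ ω ∈ G, ∀ z, shift z ω ∈ G) (h : ∀ᵐ ω ∂P, ω ∈ G) (N : ℕ) :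
    ∀ᵐ ω ∂avgLaw P N, ω ∈ G := by
  refine Measure.ae_smul_measure ?_ _
  rw [ae_iff, Measure.finsetSum_apply]
  exact Finset.sum_eq_zero fun m _ => ae_iff.1 (ae_envLaw_mem hG hs h m)

lemma integral_avgLaw {E : Type*} [NormedAddCommGroup E] [NormedSpace ℝ E]
    (P : Measure (Env d)) (N : ℕ) {f : Env d → E} (hf : ∀ m, Integrable f (envLaw P m)) :
    ∫ ω, f ω ∂avgLaw P N = (N : ℝ)⁻¹ • ∑ m ∈ Finset.Icc 1 N, ∫ ω, f ω ∂envLaw P m := by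
  rw [avgLaw, integral_smul_measure, integral_finsetSum_measure fun m _ => hf m]
  simp

/-- Identifies the averages in `IsEnvLimit` as integrals against a single measure, so that weak
convergence of measures applies. -/
lemma integral_avgLaw_bcf (P : Measure (Env d)) [IsProbabilityMeasure P] (N : ℕ)
    (F : Env d →ᵇ ℝ) :
    ∫ ω, F ω ∂avgLaw P N = (N : ℝ)⁻¹ * ∑ m ∈ Finset.Icc 1 N,
        ∫ ω, (∫ X, F (shift (X m) ω) ∂(quenched ω 0)) ∂P := by
  rw [integral_avgLaw P N fun m => F.integrable _, smul_eq_mul]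
  congr 1
  refine Finset.sum_congr rfl fun m _ => ?_
  rw [integral_envLaw P m F.continuous.stronglyMeasurable (F.integrable _)]
  refine integral_congr_ae (Eventually.of_forall fun ω => ?_)
  exact integral_map (measurable_pi_apply m).aemeasurable AEStronglyMeasurable.of_discrete

/-! ### Weak limits tested on functions continuous on a closed set of full measure -/

section Weak

lemma integrable_of_continuousOn {X : Type*} [TopologicalSpace X] [MeasurableSpace X]
    [BorelSpace X] {ν : Measure X} {E : Type*} [NormedAddCommGroup E] [SecondCountableTopology E]
    [TopologicalSpace.PseudoMetrizableSpace X] [IsProbabilityMeasure ν]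
    {G : Set X} (hG : IsClosed G) (hνG : ∀ᵐ x ∂ν, x ∈ G) {f : X → E}
    (hf : ContinuousOn f G) {C : ℝ} (hC : ∀ x ∈ G, ‖f x‖ ≤ C) : Integrable f ν := by
  have h := hf.aestronglyMeasurable (μ := ν) hG.measurableSet
  rw [Measure.restrict_eq_self_of_ae_mem hνG] at h
  exact Integrable.of_bound h C (hνG.mono hC)

variable {X : Type*} [TopologicalSpace X] [MeasurableSpace X] [BorelSpace X]
  [HasOuterApproxClosed X] {Q : ℕ → Measure X} {ν : Measure X}

lemma ae_mem_of_tendsto (hQ : ∀ j, IsProbabilityMeasure (Q j)) [hν : IsProbabilityMeasure ν]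
    (h : ∀ F : X →ᵇ ℝ, Tendsto (fun j => ∫ x, F x ∂Q j) atTop (𝓝 (∫ x, F x ∂ν)))
    {G : Set X} (hG : IsClosed G) (hQG : ∀ j, ∀ᵐ x ∂Q j, x ∈ G) : ∀ᵐ x ∂ν, x ∈ G := by
  have h1 : Tendsto (β := ProbabilityMeasure X) (fun j => ⟨Q j, hQ j⟩) atTop (𝓝 ⟨ν, hν⟩) :=
    ProbabilityMeasure.tendsto_iff_forall_integral_tendsto.2 h
  have h2 := ProbabilityMeasure.limsup_measure_closed_le_of_tendsto h1 hG
  have h3 : ∀ j, Q j G = 1 := fun j => by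
    have := hQ j
    exact prob_compl_eq_zero_iff hG.measurableSet |>.1 (hQG j)
  simp only [ProbabilityMeasure.coe_mk, h3, limsup_const] at h2
  have h4 : ν G = 1 := le_antisymm prob_le_one h2
  exact (prob_compl_eq_zero_iff hG.measurableSet).2 h4

/-- Tietze: the restriction of `f` to `G` extends to a bounded continuous function on `X`. The
extension equals `f` almost everywhere for each `Q j` and, by the portmanteau theorem, for the
limit. -/
lemma tendsto_integral_of_continuousOn [NormalSpace X]
    (hQ : ∀ j, IsProbabilityMeasure (Q j)) [hν : IsProbabilityMeasure ν]
    (h : ∀ F : X →ᵇ ℝ, Tendsto (fun j => ∫ x, F x ∂Q j) atTop (𝓝 (∫ x, F x ∂ν)))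
    {G : Set X} (hG : IsClosed G) (hQG : ∀ j, ∀ᵐ x ∂Q j, x ∈ G) {f : X → ℝ}
    (hf : ContinuousOn f G) {C : ℝ} (hC : ∀ x ∈ G, |f x| ≤ C) :
    Tendsto (fun j => ∫ x, f x ∂Q j) atTop (𝓝 (∫ x, f x ∂ν)) := by
  let f' : G →ᵇ ℝ := BoundedContinuousFunction.ofNormedAddCommGroup (G.domRestrict f)
    (continuousOn_iff_continuous_domRestrict.1 hf) C fun x => hC x x.2
  obtain ⟨F, -, hF⟩ := BoundedContinuousFunction.exists_norm_eq_domRestrict_eq_of_closed f' hG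
  have hFf : ∀ x ∈ G, F x = f x := fun x hx =>
    congrArg (fun g : G →ᵇ ℝ => g ⟨x, hx⟩) hF
  have hνG := ae_mem_of_tendsto hQ h hG hQG
  have h1 : ∀ j, ∫ x, f x ∂Q j = ∫ x, F x ∂Q j := fun j =>
    integral_congr_ae ((hQG j).mono fun x hx => (hFf x hx).symm)
  have h2 : ∫ x, f x ∂ν = ∫ x, F x ∂ν :=
    integral_congr_ae (hνG.mono fun x hx => (hFf x hx).symm)
  simp only [h1, h2]
  exact h F

lemma tendsto_integral_of_continuousOn_euclidean [NormalSpace X]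
    [TopologicalSpace.PseudoMetrizableSpace X]
    (hQ : ∀ j, IsProbabilityMeasure (Q j)) [hν : IsProbabilityMeasure ν]
    (h : ∀ F : X →ᵇ ℝ, Tendsto (fun j => ∫ x, F x ∂Q j) atTop (𝓝 (∫ x, F x ∂ν)))
    {G : Set X} (hG : IsClosed G) (hQG : ∀ j, ∀ᵐ x ∂Q j, x ∈ G)
    {f : X → EuclideanSpace ℝ (Fin d)}
    (hf : ContinuousOn f G) {C : ℝ} (hC : ∀ x ∈ G, ‖f x‖ ≤ C) :
    Tendsto (fun j => ∫ x, f x ∂Q j) atTop (𝓝 (∫ x, f x ∂ν)) := by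
  have hνG := ae_mem_of_tendsto hQ h hG hQG
  have hint : ∀ j, Integrable f (Q j) := fun j =>
    have := hQ j; integrable_of_continuousOn hG (hQG j) hf hC
  have hintν : Integrable f ν := integrable_of_continuousOn hG hνG hf hC
  rw [(EuclideanSpace.equiv (Fin d) ℝ).toHomeomorph.isInducing.tendsto_nhds_iff, tendsto_pi_nhds]
  intro i
  have hp : ∀ (Q : Measure X), Integrable f Q →
      (∫ x, f x ∂Q) i = ∫ x, f x i ∂Q := fun Q hQi =>
    ((EuclideanSpace.proj i : EuclideanSpace ℝ (Fin d) →L[ℝ] ℝ).integral_comp_comm hQi).symm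
  simp only [Function.comp_def]
  change Tendsto (fun j => (∫ x, f x ∂Q j) i) atTop (𝓝 ((∫ x, f x ∂ν) i))
  simp only [hp _ (hint _), hp _ hintν]
  refine tendsto_integral_of_continuousOn hQ h hG hQG (C := C)
    ((EuclideanSpace.proj i : EuclideanSpace ℝ (Fin d) →L[ℝ] ℝ).continuous.comp_continuousOn hf) ?_
  exact fun x hx => (PiLp.norm_apply_le (f x) i).trans (hC x hx)

end Weak

/-! ### Drift estimates: the walk rarely backtracks -/

/-- The height of a site in the direction `u`. -/
def height (u z : Site d) : ℝ := ((z ⬝ᵥ u : ℤ) : ℝ)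

lemma height_add (u x y : Site d) : height u (x + y) = height u x + height u y := by
  simp [height, add_dotProduct]

lemma height_sub (u x y : Site d) : height u (x - y) = height u x - height u y := by
  simp [height, sub_dotProduct]

lemma height_zero (u : Site d) : height u 0 = 0 := by simp [height]

/-- Environments in which `exp (-s X·u)` contracts in mean by a factor `r` at each step. -/
def drifting (u : Site d) (s r : ℝ) : Set (Env d) :=
  {ω | ∀ x, walk Set.univ ω (fun z => ENNReal.ofReal (Real.exp (-(s * height u z)))) x ≤
    ENNReal.ofReal r * ENNReal.ofReal (Real.exp (-(s * height u x)))}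

lemma shift_mem_drifting {u : Site d} {s r : ℝ} {ω : Env d} (h : ω ∈ drifting u s r)
    (z : Site d) : shift z ω ∈ drifting u s r := by
  intro x
  have h1 := walk_shift Set.univ ω z
    (fun w => ENNReal.ofReal (Real.exp (-(s * height u (w - z))))) x
  simp only [add_sub_cancel_right, Set.preimage_univ] at h1
  rw [h1]
  have h2 := h (x + z)
  have h3 : ∀ w, ENNReal.ofReal (Real.exp (-(s * height u (w - z)))) =
      ENNReal.ofReal (Real.exp (s * height u z)) *
        ENNReal.ofReal (Real.exp (-(s * height u w))) := by
    intro w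
    rw [← ENNReal.ofReal_mul (Real.exp_pos _).le, ← Real.exp_add, height_sub]
    congr 2
    ring
  simp only [h3]
  rw [walk_const_mul]
  beta_reduce
  calc _ ≤ ENNReal.ofReal (Real.exp (s * height u z)) *
        (ENNReal.ofReal r * ENNReal.ofReal (Real.exp (-(s * height u (x + z))))) := by gcongr
    _ = ENNReal.ofReal r * ENNReal.ofReal (Real.exp (-(s * height u x))) := by
        have := h3 (x + z)
        rw [add_sub_cancel_right] at this
        rw [this]
        ring

/-- Chernoff bound: the indicator is dominated by an exponential of the height, which contracts by
`r` at each step. -/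
lemma walk_low_le {u : Site d} {s r : ℝ} (hs : 0 ≤ s) {ω : Env d} (h : ω ∈ drifting u s r)
    (i : ℕ) (x : Site d) (c : ℝ) :
    (walk Set.univ ω)^[i] ({z | height u z ≤ height u x + c}.indicator 1) x ≤
      ENNReal.ofReal (Real.exp (s * c)) * ENNReal.ofReal r ^ i := by
  have h1 : {z | height u z ≤ height u x + c}.indicator 1 ≤ fun z =>
      ENNReal.ofReal (Real.exp (s * (height u x + c))) *
        ENNReal.ofReal (Real.exp (-(s * height u z))) := by
    intro z
    by_cases hz : height u z ≤ height u x + c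
    swap
    · rw [Set.indicator_of_notMem (by exact hz)]
      exact zero_le
    rw [Set.indicator_of_mem (by exact hz)]
    beta_reduce
    rw [← ENNReal.ofReal_mul (Real.exp_pos _).le, ← Real.exp_add, Pi.one_apply,
      ENNReal.one_le_ofReal]
    refine Real.one_le_exp ?_
    have := mul_le_mul_of_nonneg_left hz hs
    linarith
  refine (walk_iterate_mono le_rfl ω i h1 x).trans ?_
  rw [walk_iterate_const_mul]
  calc _ ≤ ENNReal.ofReal (Real.exp (s * (height u x + c))) *
        (ENNReal.ofReal r ^ i * ENNReal.ofReal (Real.exp (-(s * height u x)))) := by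
        gcongr
        exact walk_iterate_le_of_walk_le h i x
    _ = ENNReal.ofReal (Real.exp (s * (height u x + c))) *
        ENNReal.ofReal (Real.exp (-(s * height u x))) * ENNReal.ofReal r ^ i := by ring
    _ = _ := by
        rw [← ENNReal.ofReal_mul (Real.exp_pos _).le, ← Real.exp_add]
        congr 3
        ring

lemma hit_killed_ne_top (S : Set (Site d)) (ω : Env d) (n : ℕ) (x y : Site d) :
    hit S ω n x y ≠ ∞ := ((hit_le_one S ω n x y).trans_lt ENNReal.one_lt_top).ne

/-- The walk rarely goes below its starting height by `b` or more. -/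
lemma tsum_hit_sub_killed_le {u : Site d} {s r : ℝ} (hs : 0 ≤ s) {ω : Env d}
    (h : ω ∈ drifting u s r) (b : ℝ) (n : ℕ) :
    ∑' z, (hit Set.univ ω n 0 z - hit {z | -b ≤ height u z} ω n 0 z) ≤
      ENNReal.ofReal (Real.exp (-(s * b))) * (1 - ENNReal.ofReal r)⁻¹ := by
  set S : Set (Site d) := {z | -b ≤ height u z} with hS
  have h1 := walk_iterate_le_killed_add S ω n 1 0
  simp only [walk_iterate_one] at h1
  have h2 : ∑' z, hit S ω n 0 z = (walk S ω)^[n] 1 0 := by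
    rw [walk_iterate_eq_tsum]; simp
  have h3 : ∑' z, hit S ω n 0 z ≠ ∞ :=
    ((ENNReal.tsum_le_tsum fun z => hit_le_hit_univ S ω n 0 z).trans_lt
      (by rw [tsum_hit]; exact ENNReal.one_lt_top)).ne
  have h4 : ∑' z, (hit Set.univ ω n 0 z - hit S ω n 0 z) =
      ∑' z, hit Set.univ ω n 0 z - ∑' z, hit S ω n 0 z := by
    refine ENNReal.eq_sub_of_add_eq h3 ?_
    rw [← ENNReal.tsum_add]
    exact tsum_congr fun z => tsub_add_cancel_of_le (hit_le_hit_univ S ω n 0 z)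
  rw [h4, tsum_hit, h2, tsub_le_iff_left]
  refine h1.trans (add_le_add le_rfl ?_)
  -- Union bound over the time `i` at which the walk is found outside `S`.
  calc ∑ i ∈ Finset.range n, (walk Set.univ ω)^[i] (Sᶜ.indicator 1) 0
      ≤ ∑ i ∈ Finset.range n, ENNReal.ofReal (Real.exp (-(s * b))) * ENNReal.ofReal r ^ i := by
        refine Finset.sum_le_sum fun i _ => ?_
        have := walk_low_le hs h i 0 (-b)
        rw [mul_neg] at this
        refine le_trans (walk_iterate_mono le_rfl ω i ?_ 0) this
        refine Set.indicator_le_indicator_of_subset (fun z hz => ?_) fun _ => zero_le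
        simp only [hS, Set.mem_compl_iff, Set.mem_ofPred_eq, not_le] at hz
        simp only [height_zero, zero_add, Set.mem_ofPred_eq]
        exact hz.le
    _ ≤ ENNReal.ofReal (Real.exp (-(s * b))) * ∑' i, ENNReal.ofReal r ^ i := by
        rw [← Finset.mul_sum]
        gcongr
        exact ENNReal.sum_le_tsum _
    _ = _ := by rw [ENNReal.tsum_geometric]

/-- The walk has rarely been higher than its current position by `b` or more. -/
lemma tsum_hit_sub_past_le {u : Site d} {s r : ℝ} (hs : 0 ≤ s) {ω : Env d}
    (h : ω ∈ drifting u s r) (b : ℝ) (m : ℕ) :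
    ∑' x, (hit Set.univ ω m 0 x - hit {w | height u w < height u x + b} ω m 0 x) ≤
      ENNReal.ofReal (Real.exp (-(s * b))) * (1 - ENNReal.ofReal r)⁻¹ := by
  classical
  -- A path to `x` through a site `w` at least `b` higher, visited at time `i`, must descend by `b`
  -- in the remaining `m - i` steps.
  have h1 : ∀ x, hit Set.univ ω m 0 x - hit {w | height u w < height u x + b} ω m 0 x ≤
      ∑ i ∈ Finset.range m, (walk Set.univ ω)^[i] (fun w =>
        ({z | height u z ≤ height u w + -b}.indicator 1 x : ℝ≥0∞) *
          hit Set.univ ω (m - i) w x) 0 := by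
    intro x
    rw [tsub_le_iff_left]
    refine (walk_iterate_le_killed_add {w | height u w < height u x + b} ω m
      (Pi.single x 1) 0).trans (add_le_add le_rfl (Finset.sum_le_sum fun i _ => ?_))
    refine walk_iterate_mono le_rfl ω i (fun w => ?_) 0
    by_cases hw : w ∈ {w | height u w < height u x + b}ᶜ
    swap
    · rw [Set.indicator_of_notMem hw]
      exact zero_le
    rw [Set.indicator_of_mem hw]
    have hw' : x ∈ {z | height u z ≤ height u w + -b} := by
      simp only [Set.mem_compl_iff, Set.mem_ofPred_eq, not_lt] at hw ⊢
      linarith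
    rw [Set.indicator_of_mem hw', Pi.one_apply, one_mul]
    exact le_rfl
  calc _ ≤ ∑' x, ∑ i ∈ Finset.range m, (walk Set.univ ω)^[i] (fun w =>
        ({z | height u z ≤ height u w + -b}.indicator 1 x : ℝ≥0∞) *
          hit Set.univ ω (m - i) w x) 0 := ENNReal.tsum_le_tsum h1
    _ = ∑ i ∈ Finset.range m, (walk Set.univ ω)^[i] (fun w => (walk Set.univ ω)^[m - i]
          ({z | height u z ≤ height u w + -b}.indicator 1) w) 0 := by
        rw [Summable.tsum_finsetSum fun _ _ => ENNReal.summable]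
        refine Finset.sum_congr rfl fun i _ => ?_
        rw [← walk_iterate_tsum]
        refine congrArg (fun g => (walk Set.univ ω)^[i] g 0) (funext fun w => ?_)
        rw [walk_iterate_eq_tsum]
        exact tsum_congr fun x => mul_comm _ _
    _ ≤ ∑ i ∈ Finset.range m, ENNReal.ofReal (Real.exp (-(s * b))) *
          ENNReal.ofReal r ^ (m - i) := by
        refine Finset.sum_le_sum fun i _ => ?_
        refine (walk_iterate_mono le_rfl ω i (fun w => ?_) 0).trans
          (walk_iterate_const ω i _ 0).le
        have := walk_low_le hs h (m - i) w (-b)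
        rwa [mul_neg] at this
    _ ≤ ENNReal.ofReal (Real.exp (-(s * b))) * ∑' i, ENNReal.ofReal r ^ i := by
        rw [← Finset.mul_sum]
        gcongr
        refine le_trans ?_ (ENNReal.sum_le_tsum (Finset.range (m + 1)))
        -- The range `m + 1` makes room for the reflection `i ↦ m - i`; the added term is
        -- nonnegative.
        rw [← Finset.sum_flip]
        exact Finset.sum_le_sum_of_subset (Finset.range_mono (Nat.le_succ m))
    _ = _ := by rw [ENNReal.tsum_geometric]

/-! ### Localising the quenched mean to a half-space -/

/-- The mean of `X_n` on the event that the walk stays in `S` before time `n`. -/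
def killedMean (S : Set (Site d)) (ω : Env d) (n : ℕ) : EuclideanSpace ℝ (Fin d) :=
  ∑' z, (hit S ω n 0 z).toReal • toVec z

lemma measurable_killedMean {Ω' : Type*} [MeasurableSpace Ω'] {W : Ω' → Env d}
    {S : Set (Site d)} (hW : ∀ x ∈ S, Measurable fun o => W o x) (n : ℕ) :
    Measurable fun o => killedMean S (W o) n :=
  Measurable.tsum fun z => (measurable_hit hW n 0 z).ennreal_toReal.smul_const (toVec z)

lemma quenchedMean_eq_tsum {s A : ℝ} (hs : 0 < s) (hA : 1 ≤ A) {ω : Env d}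
    (h : ω ∈ tame d s A) (n : ℕ) :
    quenchedMean ω n = ∑' z, (hit Set.univ ω n 0 z).toReal • toVec z := by
  rw [quenchedMean_eq, integral_countable (integrable_toVec hs hA h n 0)]
  simp only [measureReal_def, law_singleton]

lemma enorm_toReal_smul {a : ℝ≥0∞} (ha : a ≠ ∞) (v : EuclideanSpace ℝ (Fin d)) :
    ‖a.toReal • v‖ₑ = a * ‖v‖ₑ := by
  rw [enorm_smul, Real.enorm_of_nonneg ENNReal.toReal_nonneg, ENNReal.ofReal_toReal ha]

/-- Truncation at level `B`: `|z| ≤ B + |z|² / B` splits the lost mass into `B` times the small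
probability of leaving the half-space and the second moment divided by `B`. -/
lemma enorm_quenchedMean_sub_killedMean_le {u : Site d} {s s' A r : ℝ} (hs : 0 < s) (hs' : 0 ≤ s')
    (hA : 1 ≤ A) {ω : Env d} (h : ω ∈ tame d s A) (h' : ω ∈ drifting u s' r) (n : ℕ) (b : ℝ)
    {B : ℝ} (hB : 0 < B) :
    ‖quenchedMean ω n - killedMean {z | -b ≤ height u z} ω n‖ₑ ≤
      ENNReal.ofReal B * (ENNReal.ofReal (Real.exp (-(s' * b))) * (1 - ENNReal.ofReal r)⁻¹) +
        ENNReal.ofReal (B⁻¹ * (4 * A / s ^ 2 * n ^ 2)) := by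
  set S : Set (Site d) := {z | -b ≤ height u z} with hS
  have hm : ∑' z, hit Set.univ ω n 0 z * ‖toVec z‖ₑ ≠ ∞ := by
    have h1 := lintegral_law_enorm_le hs hA h n 0
    rw [lintegral_law, walk_iterate_eq_tsum] at h1
    simp only [sub_zero] at h1
    exact (h1.trans_lt ENNReal.ofReal_lt_top).ne
  have hsum : ∀ S : Set (Site d), Summable fun z => (hit S ω n 0 z).toReal • toVec z := by
    intro S
    refine Summable.of_enorm (ne_top_of_le_ne_top hm (ENNReal.tsum_le_tsum fun z => ?_))
    rw [enorm_toReal_smul (hit_killed_ne_top _ _ _ _ _)]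
    gcongr
    exact hit_le_hit_univ S ω n 0 z
  rw [quenchedMean_eq_tsum hs hA h, killedMean, ← (hsum Set.univ).tsum_sub (hsum S)]
  refine enorm_tsum_le_tsum_enorm.trans ?_
  have hterm : ∀ z, ‖(hit Set.univ ω n 0 z).toReal • toVec z - (hit S ω n 0 z).toReal • toVec z‖ₑ ≤
      ENNReal.ofReal B * (hit Set.univ ω n 0 z - hit S ω n 0 z) +
        ENNReal.ofReal B⁻¹ * (hit Set.univ ω n 0 z * ‖toVec z‖ₑ ^ 2) := by
    intro z
    rw [← sub_smul, ← ENNReal.toReal_sub_of_le (hit_le_hit_univ S ω n 0 z)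
      (hit_killed_ne_top _ _ _ _ _), enorm_toReal_smul
      (ne_top_of_le_ne_top (hit_killed_ne_top Set.univ ω n 0 z) tsub_le_self)]
    have h1 : ‖toVec z‖ₑ ≤ ENNReal.ofReal B + ENNReal.ofReal B⁻¹ * ‖toVec z‖ₑ ^ 2 := by
      rw [← ofReal_norm, ← ENNReal.ofReal_pow (norm_nonneg _),
        ← ENNReal.ofReal_mul (by positivity), ← ENNReal.ofReal_add hB.le (by positivity)]
      refine ENNReal.ofReal_le_ofReal ?_
      rcases le_total ‖toVec z‖ B with h2 | h2
      · have : 0 ≤ B⁻¹ * ‖toVec z‖ ^ 2 := by positivity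
        linarith
      · have : ‖toVec z‖ ≤ B⁻¹ * ‖toVec z‖ ^ 2 := by
          rw [pow_two, ← mul_assoc]
          refine le_mul_of_one_le_left (norm_nonneg _) ?_
          rwa [inv_mul_eq_div, one_le_div hB]
        linarith
    calc _ ≤ (hit Set.univ ω n 0 z - hit S ω n 0 z) *
          (ENNReal.ofReal B + ENNReal.ofReal B⁻¹ * ‖toVec z‖ₑ ^ 2) := by gcongr
      _ = ENNReal.ofReal B * (hit Set.univ ω n 0 z - hit S ω n 0 z) + ENNReal.ofReal B⁻¹ *
          ((hit Set.univ ω n 0 z - hit S ω n 0 z) * ‖toVec z‖ₑ ^ 2) := by ring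
      _ ≤ _ := by
          gcongr
          exact tsub_le_self
  refine (ENNReal.tsum_le_tsum hterm).trans ?_
  rw [ENNReal.tsum_add, ENNReal.tsum_mul_left, ENNReal.tsum_mul_left,
    ENNReal.ofReal_mul (by positivity)]
  gcongr
  · exact tsum_hit_sub_killed_le hs' h' b n
  · have h1 := lintegral_law_enorm_sq_le hs hA h n 0
    rw [lintegral_law, walk_iterate_eq_tsum] at h1
    simpa only [sub_zero] using h1

/-! ### Independence and stationarity of the product environment -/

section Product

variable (μ : Measure (ProbVec d)) [IsProbabilityMeasure μ]

instance : IsProbabilityMeasure (envMeasure μ) := by unfold envMeasure; infer_instance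

/-- The σ-algebra of the environment on `S`. -/
abbrev envAlgebra (S : Set (Site d)) : MeasurableSpace (Env d) :=
  ⨆ x ∈ S, MeasurableSpace.comap (fun ω : Env d => ω x) inferInstance

lemma measurable_eval_envAlgebra {S : Set (Site d)} {x : Site d} (hx : x ∈ S) :
    Measurable[envAlgebra S] fun ω : Env d => ω x :=
  (comap_measurable _).mono (le_iSup₂ (f := fun (x : Site d) (_ : x ∈ S) =>
    MeasurableSpace.comap (fun ω : Env d => ω x) inferInstance) x hx) le_rfl

lemma envAlgebra_le (S : Set (Site d)) : envAlgebra S ≤ MeasurableSpace.pi :=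
  iSup₂_le fun x _ => (measurable_pi_apply x).comap_le

lemma lintegral_mul_envMeasure {S T : Set (Site d)} (hST : Disjoint S T) {f g : Env d → ℝ≥0∞}
    (hf : Measurable[envAlgebra S] f) (hg : Measurable[envAlgebra T] g) :
    ∫⁻ ω, f ω * g ω ∂envMeasure μ = (∫⁻ ω, f ω ∂envMeasure μ) * ∫⁻ ω, g ω ∂envMeasure μ := by
  refine lintegral_mul_eq_lintegral_mul_lintegral_of_independent_measurableSpace
    (envAlgebra_le S) (envAlgebra_le T) ?_ hf hg
  refine indep_iSup_of_disjoint (m := fun x : Site d =>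
    MeasurableSpace.comap (fun ω : Env d => ω x) inferInstance)
    (fun x => (measurable_pi_apply x).comap_le) ?_ hST
  exact iIndepFun_infinitePi (P := fun _ : Site d => μ) (X := fun _ p => p) (fun _ => measurable_id)

lemma measurePreserving_shift (z : Site d) :
    MeasurePreserving (shift z) (envMeasure μ) (envMeasure μ) := by
  refine ⟨measurable_shift z, ?_⟩
  have := Measure.infinitePi_map_piCongrLeft (fun _ : Site d => μ) (Equiv.subRight z)
  rw [envMeasure]
  convert! this using 2
  funext ω x
  simp only [MeasurableEquiv.coe_piCongrLeft]
  have := Equiv.piCongrLeft_apply_apply (fun _ : Site d => ProbVec d) (Equiv.subRight z) ω (x + z)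
  simpa [shift] using this.symm

end Product

/-! ### Decoupling the past from the future across a gap of `k` steps -/

/-- Splitting the expectation at time `m + k` according to whether the walk has climbed by `2b`
between times `m` and `m + k`, and whether up to time `m` it stayed below its height at
time `m` plus `b`. -/
lemma walk_add_le_split {u : Site d} {s r : ℝ} (hs : 0 ≤ s) {ω : Env d} (h : ω ∈ drifting u s r)
    (b : ℝ) (m k : ℕ) {f g w : Site d → ℝ≥0∞} {B e : ℝ≥0∞} (hB : ∀ y, f y ≤ B)
    (hg : ∀ y, f y ≤ g y + e) (hw : ∀ x y, hit Set.univ ω k x y ≤ w (y - x)) :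
    (walk Set.univ ω)^[m + k] f 0 ≤
      B * (ENNReal.ofReal (Real.exp (s * (2 * b))) * ENNReal.ofReal r ^ k) +
      B * (ENNReal.ofReal (Real.exp (-(s * b))) * (1 - ENNReal.ofReal r)⁻¹) + e +
      ∑' x, ∑' y, {y | height u x + 2 * b < height u y}.indicator (fun y =>
        w (y - x) * (hit {v | height u v < height u x + b} ω m 0 x * g y)) y := by
  set p := hit Set.univ ω m 0 with hp
  set q := hit Set.univ ω k with hq
  set p' : Site d → ℝ≥0∞ := fun x => hit {v | height u v < height u x + b} ω m 0 x with hp'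
  have hpp : ∀ x, p' x ≤ p x := fun x => hit_le_hit_univ _ ω m 0 x
  set J : Site d → Site d → ℝ≥0∞ := fun x y => {y | height u x + 2 * b < height u y}.indicator
    (fun y => w (y - x) * (p' x * g y)) y with hJ
  -- The four terms: the gap climbs too little; the past went too high; the error of replacing `f`
  -- by `g`; and the good part, where `q` is replaced by the deterministic `w`.
  have hterm : ∀ x y, p x * (q x y * f y) ≤
      B * (p x * (q x y * {z | height u z ≤ height u x + 2 * b}.indicator 1 y)) +
      B * ((p x - p' x) * q x y) + e * (p x * q x y) + J x y := by
    intro x y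
    by_cases hy : height u y ≤ height u x + 2 * b
    · calc p x * (q x y * f y) ≤ p x * (q x y * B) := by gcongr; exact hB y
        _ = B * (p x * (q x y * {z | height u z ≤ height u x + 2 * b}.indicator 1 y)) := by
          rw [Set.indicator_of_mem (by exact hy), Pi.one_apply]; ring
        _ ≤ _ := by rw [add_assoc, add_assoc]; exact le_self_add
    · have hJy : J x y = w (y - x) * (p' x * g y) :=
        Set.indicator_of_mem (by simpa using hy) _
      calc p x * (q x y * f y) = (p x - p' x) * (q x y * f y) + p' x * (q x y * f y) := by
            rw [← add_mul, tsub_add_cancel_of_le (hpp x)]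
        _ ≤ (p x - p' x) * (q x y * B) + p' x * (q x y * (g y + e)) := by
            gcongr
            · exact hB y
            · exact hg y
        _ = B * ((p x - p' x) * q x y) + e * (p' x * q x y) + q x y * (p' x * g y) := by ring
        _ ≤ B * ((p x - p' x) * q x y) + e * (p x * q x y) + J x y := by
            rw [hJy]
            gcongr
            · exact hpp x
            · exact hw x y
        _ ≤ _ := by
            rw [add_assoc _ _ (J x y), add_assoc _ _ (J x y), add_assoc]
            exact le_add_self
  rw [Function.iterate_add_apply, walk_iterate_eq_tsum]
  calc ∑' x, hit Set.univ ω m 0 x * (walk Set.univ ω)^[k] f x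
      = ∑' x, ∑' y, p x * (q x y * f y) := by
        refine tsum_congr fun x => ?_
        rw [walk_iterate_eq_tsum, ENNReal.tsum_mul_left]
    _ ≤ ∑' x, ∑' y, (B * (p x * (q x y * {z | height u z ≤ height u x + 2 * b}.indicator 1 y)) +
      B * ((p x - p' x) * q x y) + e * (p x * q x y) + J x y) :=
        ENNReal.tsum_le_tsum fun x => ENNReal.tsum_le_tsum fun y => hterm x y
    _ ≤ _ := by
        simp only [ENNReal.tsum_add, ENNReal.tsum_mul_left]
        gcongr
        · calc _ ≤ ∑' x, p x *
                (ENNReal.ofReal (Real.exp (s * (2 * b))) * ENNReal.ofReal r ^ k) := by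
                refine ENNReal.tsum_le_tsum fun x => ?_
                gcongr
                have := walk_low_le hs h k x (2 * b)
                rwa [walk_iterate_eq_tsum] at this
            _ = _ := by rw [ENNReal.tsum_mul_right, hp, tsum_hit, one_mul]
        · simp only [hq, tsum_hit, mul_one]
          exact tsum_hit_sub_past_le hs h b m
        · simp only [hq, hp, tsum_hit, mul_one]
          exact le_rfl

lemma enorm_sq_le_two_mul {E : Type*} [NormedAddCommGroup E] (x y : E) :
    ‖x‖ₑ ^ 2 ≤ 2 * ‖y‖ₑ ^ 2 + 2 * ‖x - y‖ₑ ^ 2 := by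
  have h1 : ‖x‖ ≤ ‖y‖ + ‖x - y‖ := by
    have := norm_add_le y (x - y)
    simpa using this
  simp only [← ofReal_norm]
  rw [← ENNReal.ofReal_pow (norm_nonneg _), ← ENNReal.ofReal_pow (norm_nonneg _),
    ← ENNReal.ofReal_pow (norm_nonneg _), show (2 : ℝ≥0∞) = ENNReal.ofReal 2 by simp,
    ← ENNReal.ofReal_mul (by norm_num), ← ENNReal.ofReal_mul (by norm_num),
    ← ENNReal.ofReal_add (by positivity) (by positivity)]
  refine ENNReal.ofReal_le_ofReal ?_
  nlinarith [sq_nonneg (‖y‖ - ‖x - y‖), norm_nonneg x, norm_nonneg y, norm_nonneg (x - y)]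

section Product

variable (μ : Measure (ProbVec d)) [IsProbabilityMeasure μ]

/-- The past factor reads sites below height `x·u + b`, the future factor sites above it, so the
expectation factorises. Stationarity removes the shift by `y`, summing over `y` leaves the mass of
`w`, and the past factors sum over `x` to at most one. -/
lemma lintegral_decoupled_le {u : Site d} (b : ℝ) (m : ℕ) {w : Site d → ℝ≥0∞}
    {F : Env d → ℝ≥0∞} (hF : Measurable[envAlgebra {z | -b ≤ height u z}] F) :
    ∫⁻ ω, ∑' x, ∑' y, {y | height u x + 2 * b < height u y}.indicator (fun y =>
        w (y - x) * (hit {v | height u v < height u x + b} ω m 0 x * F (shift y ω))) y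
        ∂envMeasure μ ≤
      (∑' z, w z) * ∫⁻ ω, F ω ∂envMeasure μ := by
  have hF' : Measurable F := hF.mono (envAlgebra_le _) le_rfl
  have hm : ∀ x y, Measurable fun ω : Env d =>
      hit {v | height u v < height u x + b} ω m 0 x * F (shift y ω) := fun x y =>
    (measurable_hit (fun z _ => measurable_pi_apply z) m 0 x).mul (hF'.comp (measurable_shift y))
  have hm2 : ∀ x y, Measurable fun ω : Env d =>
      {y | height u x + 2 * b < height u y}.indicator (fun y =>
        w (y - x) * (hit {v | height u v < height u x + b} ω m 0 x * F (shift y ω))) y := by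
    intro x y
    by_cases hy : y ∈ {y | height u x + 2 * b < height u y}
    · simp only [Set.indicator_of_mem hy]
      exact (hm x y).const_mul _
    · simp only [Set.indicator_of_notMem hy]
      exact measurable_const
  rw [lintegral_tsum fun x => (Measurable.tsum fun y => hm2 x y).aemeasurable]
  simp only [lintegral_tsum fun y => (hm2 _ y).aemeasurable]
  have hxy : ∀ x y, ∫⁻ ω, {y | height u x + 2 * b < height u y}.indicator (fun y =>
        w (y - x) * (hit {v | height u v < height u x + b} ω m 0 x * F (shift y ω))) y
        ∂envMeasure μ ≤
      w (y - x) * ((∫⁻ ω, hit Set.univ ω m 0 x ∂envMeasure μ) * ∫⁻ ω, F ω ∂envMeasure μ) := by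
    intro x y
    by_cases hy : y ∈ {y | height u x + 2 * b < height u y}
    · simp only [Set.indicator_of_mem hy]
      rw [lintegral_const_mul _ (hm x y)]
      have hd : Disjoint {v | height u v < height u x + b} {v | height u x + b ≤ height u v} :=
        Set.disjoint_left.2 fun v hv hv' =>
          absurd (show height u v < height u x + b from hv) (not_lt.2 hv')
      have h1 : Measurable[envAlgebra {v | height u v < height u x + b}] fun ω : Env d =>
          hit {v | height u v < height u x + b} ω m 0 x :=
        @measurable_hit d (Env d) (envAlgebra {v | height u v < height u x + b}) (fun ω => ω) _
          (fun z hz => measurable_eval_envAlgebra hz) m 0 x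
      have h2 : Measurable[envAlgebra {v | height u x + b ≤ height u v},
          envAlgebra {z | -b ≤ height u z}] (shift y : Env d → Env d) := by
        refine Measurable.of_comap_le ?_
        rw [envAlgebra, MeasurableSpace.comap_iSup]
        refine iSup_le fun z => ?_
        rw [MeasurableSpace.comap_iSup]
        refine iSup_le fun hz => ?_
        rw [MeasurableSpace.comap_comp]
        refine (measurable_eval_envAlgebra (x := z + y) ?_).comap_le
        -- Sites at height at least `-b` relative to `y` lie above `x·u + 2b - b`, hence outside the
        -- region read by the past.
        simp only [Set.mem_ofPred_eq] at hz hy ⊢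
        rw [height_add]
        linarith
      have h3 := lintegral_mul_envMeasure μ hd h1 (hF.comp h2)
      simp only [Function.comp_apply] at h3
      rw [h3]
      exact mul_le_mul_right (mul_le_mul' (lintegral_mono fun ω => hit_le_hit_univ _ ω m 0 x)
        ((measurePreserving_shift μ y).lintegral_comp hF').le) _
    · simp only [Set.indicator_of_notMem hy, lintegral_zero]
      exact zero_le
  calc _ ≤ ∑' x, ∑' y, w (y - x) *
        ((∫⁻ ω, hit Set.univ ω m 0 x ∂envMeasure μ) * ∫⁻ ω, F ω ∂envMeasure μ) :=
        ENNReal.tsum_le_tsum fun x => ENNReal.tsum_le_tsum fun y => hxy x y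
    _ = ∑' x, (∑' z, w z) *
        ((∫⁻ ω, hit Set.univ ω m 0 x ∂envMeasure μ) * ∫⁻ ω, F ω ∂envMeasure μ) := by
        refine tsum_congr fun x => ?_
        rw [ENNReal.tsum_mul_right, ← (Equiv.subRight x).tsum_eq w]
        rfl
    _ = _ := by
        rw [ENNReal.tsum_mul_left, ENNReal.tsum_mul_right, ← lintegral_tsum fun x =>
          (measurable_hit (fun z _ => measurable_pi_apply z) m 0 x).aemeasurable]
        simp [tsum_hit]

lemma measurable_enorm_quenchedMean_sub (n : ℕ) (a : EuclideanSpace ℝ (Fin d)) :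
    Measurable fun ω : Env d => ‖quenchedMean ω n - a‖ₑ ^ 2 :=
  ((measurable_quenchedMean n).sub_const a).enorm.pow_const 2

/-- The killed mean serves only as an intermediary measurable on a half-space: `e` is paid once to
pass to it before decoupling and once to return from it afterwards. -/
lemma lintegral_envLaw_add_quenchedMean_le {u : Site d} {s s' A r : ℝ} (hs : 0 < s) (hs' : 0 ≤ s')
    (hA : 1 ≤ A) (ht : ∀ᵐ ω ∂envMeasure μ, ω ∈ tame d s A)
    (hdr : ∀ᵐ ω ∂envMeasure μ, ω ∈ drifting u s' r) (b : ℝ) {k : ℕ} (hk : k ≠ 0) (m n : ℕ)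
    {B e : ℝ≥0∞} {a : EuclideanSpace ℝ (Fin d)}
    (hB : ∀ ω ∈ tame d s A, ‖quenchedMean ω n - a‖ₑ ^ 2 ≤ B)
    (he : ∀ ω ∈ tame d s A, ω ∈ drifting u s' r →
      ‖quenchedMean ω n - killedMean {z | -b ≤ height u z} ω n‖ₑ ^ 2 ≤ e) :
    ∫⁻ ω, ‖quenchedMean ω n - a‖ₑ ^ 2 ∂envLaw (envMeasure μ) (m + k) ≤
      B * (ENNReal.ofReal (Real.exp (s' * (2 * b))) * ENNReal.ofReal r ^ k) +
      B * (ENNReal.ofReal (Real.exp (-(s' * b))) * (1 - ENNReal.ofReal r)⁻¹) + 2 * e +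
      (ENNReal.ofReal (2 * A) * ∑' z : Site d, ENNReal.ofReal (Real.exp (-(s / k * ‖toVec z‖)))) *
        (2 * (2 * ∫⁻ ω, ‖quenchedMean ω n - a‖ₑ ^ 2 ∂envMeasure μ + 2 * e)) := by
  have hφ : Measurable fun v : EuclideanSpace ℝ (Fin d) => 2 * ‖v - a‖ₑ ^ 2 :=
    ((measurable_id.sub_const a).enorm.pow_const 2).const_mul 2
  have hFm : Measurable[envAlgebra {z | -b ≤ height u z}] fun ω : Env d =>
      2 * ‖killedMean {z | -b ≤ height u z} ω n - a‖ₑ ^ 2 :=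
    hφ.comp (@measurable_killedMean d (Env d) (envAlgebra {z | -b ≤ height u z}) (fun ω => ω) _
      (fun z hz => measurable_eval_envAlgebra hz) n)
  rw [lintegral_envLaw _ _ (measurable_enorm_quenchedMean_sub n a)]
  simp only [lintegral_law]
  have hpt : ∀ᵐ ω ∂envMeasure μ,
      (walk Set.univ ω)^[m + k] (fun x => ‖quenchedMean (shift x ω) n - a‖ₑ ^ 2) 0 ≤
        B * (ENNReal.ofReal (Real.exp (s' * (2 * b))) * ENNReal.ofReal r ^ k) +
        B * (ENNReal.ofReal (Real.exp (-(s' * b))) * (1 - ENNReal.ofReal r)⁻¹) + 2 * e +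
        ∑' x, ∑' y, {y | height u x + 2 * b < height u y}.indicator (fun y =>
          ENNReal.ofReal (2 * A) * ENNReal.ofReal (Real.exp (-(s / k * ‖toVec (y - x)‖))) *
          (hit {v | height u v < height u x + b} ω m 0 x *
            (2 * ‖killedMean {z | -b ≤ height u z} (shift y ω) n - a‖ₑ ^ 2))) y := by
    filter_upwards [ht, hdr] with ω h1 h2
    exact walk_add_le_split hs' h2 b m k (B := B) (e := 2 * e)
      (w := fun z => ENNReal.ofReal (2 * A) * ENNReal.ofReal (Real.exp (-(s / k * ‖toVec z‖))))
      (g := fun y => 2 * ‖killedMean {z | -b ≤ height u z} (shift y ω) n - a‖ₑ ^ 2)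
      (fun y => hB _ (shift_mem_tame h1 y))
      (fun y => by
        refine (enorm_sq_le_two_mul _ (killedMean {z | -b ≤ height u z} (shift y ω) n - a)).trans ?_
        rw [sub_sub_sub_cancel_right]
        gcongr
        exact he _ (shift_mem_tame h1 y) (shift_mem_drifting h2 y))
      (fun x y => hit_le_exp hs.le hA h1 hk x y)
  refine (lintegral_mono_ae hpt).trans ?_
  rw [lintegral_add_left measurable_const, lintegral_const, measure_univ, mul_one]
  refine add_le_add le_rfl ((lintegral_decoupled_le μ b m (w := fun z =>
    ENNReal.ofReal (2 * A) * ENNReal.ofReal (Real.exp (-(s / k * ‖toVec z‖)))) hFm).trans ?_)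
  rw [ENNReal.tsum_mul_left]
  refine mul_le_mul_right ?_ _
  rw [lintegral_const_mul _ (by
    exact (((@measurable_killedMean d (Env d) _ (fun ω => ω) _
      (fun z _ => measurable_pi_apply z) n).sub_const a).enorm.pow_const 2))]
  refine mul_le_mul_right ?_ _
  calc _ ≤ ∫⁻ ω, (2 * ‖quenchedMean ω n - a‖ₑ ^ 2 + 2 * e) ∂envMeasure μ := by
        refine lintegral_mono_ae ?_
        filter_upwards [ht, hdr] with ω h1 h2
        refine (enorm_sq_le_two_mul _ (quenchedMean ω n - a)).trans ?_
        rw [sub_sub_sub_cancel_right]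
        gcongr
        rw [enorm_sub_rev]
        exact he _ h1 h2
    _ = _ := by
        rw [lintegral_add_right _ measurable_const, lintegral_const, measure_univ, mul_one,
          lintegral_const_mul _ (measurable_enorm_quenchedMean_sub n a)]

end Product

/-! ### Returning from time `m + k` to time `m` -/

/-- Comparing the quenched mean with its average over the position at time `k`. -/
lemma enorm_quenchedMean_sub_sq_le {s A : ℝ} (hs : 0 < s) (hA : 1 ≤ A) {ω : Env d}
    (h : ω ∈ tame d s A) (k n : ℕ) (a : EuclideanSpace ℝ (Fin d)) :
    ‖quenchedMean ω n - a‖ₑ ^ 2 ≤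
      2 * ∫⁻ y, ‖quenchedMean (shift y ω) n - a‖ₑ ^ 2 ∂law ω k 0 +
        2 * ENNReal.ofReal ((4 * A / s * k) ^ 2) := by
  have hi := integrable_quenchedMean_shift hs hA h k n 0
  have h1 : ∫ y, (quenchedMean (shift y ω) n - a) ∂law ω k 0 =
      ∫ y, quenchedMean (shift y ω) n ∂law ω k 0 - a := by
    rw [integral_sub hi (integrable_const _)]
    simp
  -- The mean at time `n + k` is expanded by the Markov property at time `k` and at time `n`. What
  -- remains are two means over `k` steps, each of order `k`.
  have h2 : quenchedMean ω n - a - ∫ y, (quenchedMean (shift y ω) n - a) ∂law ω k 0 =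
      quenchedMean ω k - ∫ y, quenchedMean (shift y ω) k ∂law ω n 0 := by
    have h3 := quenchedMean_add hs hA h k n
    rw [add_comm, quenchedMean_add hs hA h n k] at h3
    rw [h1, sub_sub_sub_cancel_right, sub_eq_sub_iff_add_eq_add, h3]
  refine (enorm_sq_le_two_mul _ (∫ y, (quenchedMean (shift y ω) n - a) ∂law ω k 0)).trans ?_
  rw [h2]
  gcongr
  · have h4 := enorm_integral_le_lintegral_enorm (μ := law ω k 0)
      fun y => quenchedMean (shift y ω) n - a
    calc _ ≤ (∫⁻ y, ‖quenchedMean (shift y ω) n - a‖ₑ ∂law ω k 0) ^ 2 := by gcongr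
      _ ≤ _ := ?_
    -- Cauchy–Schwarz against the constant 1.
    have h5 := ENNReal.lintegral_mul_le_Lp_mul_Lq (law ω k 0) Real.HolderConjugate.two_two
      (f := fun y => ‖quenchedMean (shift y ω) n - a‖ₑ) (g := fun _ => 1)
      Measurable.of_discrete.aemeasurable aemeasurable_const
    simp only [Pi.mul_apply, mul_one, lintegral_const, measure_univ, ENNReal.rpow_two, one_pow,
      ENNReal.one_rpow] at h5
    calc _ ≤ ((∫⁻ y, ‖quenchedMean (shift y ω) n - a‖ₑ ^ 2 ∂law ω k 0) ^ (1 / 2 : ℝ)) ^ 2 := by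
          gcongr
      _ = _ := by
          rw [← ENNReal.rpow_two, ← ENNReal.rpow_mul]
          norm_num
  · rw [← ofReal_norm, ← ENNReal.ofReal_pow (norm_nonneg _)]
    refine ENNReal.ofReal_le_ofReal ?_
    gcongr
    have h6 : ‖∫ y, quenchedMean (shift y ω) k ∂law ω n 0‖ ≤ 2 * A / s * k := by
      have := norm_integral_le_of_norm_le_const (μ := law ω n 0)
        (f := fun y => quenchedMean (shift y ω) k) (C := 2 * A / s * k)
        (Eventually.of_forall fun y => norm_quenchedMean_le hs hA (shift_mem_tame h y) k)
      simpa using this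
    calc _ ≤ _ := norm_sub_le _ _
      _ ≤ 2 * A / s * k + 2 * A / s * k := add_le_add (norm_quenchedMean_le hs hA h k) h6
      _ = _ := by ring

lemma measurableSet_tame (s A : ℝ) : MeasurableSet (tame d s A) := (isClosed_tame s A).measurableSet

/-- Allows the gap to be inserted after time `m`, so that every `m` is covered, including those
smaller than `k`. -/
lemma lintegral_envLaw_le_add {s A : ℝ} (hs : 0 < s) (hA : 1 ≤ A) {P : Measure (Env d)}
    [IsProbabilityMeasure P] (ht : ∀ᵐ ω ∂P, ω ∈ tame d s A) (m k n : ℕ)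
    (a : EuclideanSpace ℝ (Fin d)) :
    ∫⁻ ω, ‖quenchedMean ω n - a‖ₑ ^ 2 ∂envLaw P m ≤
      2 * ∫⁻ ω, ‖quenchedMean ω n - a‖ₑ ^ 2 ∂envLaw P (m + k) +
        2 * ENNReal.ofReal ((4 * A / s * k) ^ 2) := by
  have hm := measurable_enorm_quenchedMean_sub (d := d) n a
  rw [lintegral_envLaw_add _ _ _ hm]
  have h1 : Measurable fun ω : Env d => ∫⁻ x, ‖quenchedMean (shift x ω) n - a‖ₑ ^ 2 ∂law ω k 0 := by
    simp only [← lintegral_envKernel k _ hm]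
    exact hm.lintegral_kernel
  calc _ ≤ ∫⁻ ω, (2 * ∫⁻ x, ‖quenchedMean (shift x ω) n - a‖ₑ ^ 2 ∂law ω k 0 +
        2 * ENNReal.ofReal ((4 * A / s * k) ^ 2)) ∂envLaw P m := by
        refine lintegral_mono_ae ?_
        filter_upwards [ae_envLaw_mem (measurableSet_tame s A) (fun ω hω z => shift_mem_tame hω z)
          ht m] with ω hω
        exact enorm_quenchedMean_sub_sq_le hs hA hω k n a
    _ = _ := by
        rw [lintegral_add_right _ measurable_const, lintegral_const_mul _ h1]
        simp

/-! ### From the hypotheses at the origin to all sites -/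

lemma ae_forall_shift (μ : Measure (ProbVec d)) [IsProbabilityMeasure μ] {p : Env d → Prop}
    (h : ∀ᵐ ω ∂envMeasure μ, p ω) : ∀ᵐ ω ∂envMeasure μ, ∀ x, p (shift x ω) :=
  ae_all_iff.2 fun x => (measurePreserving_shift μ x).quasiMeasurePreserving.ae h

lemma trans_shift_zero (ω : Env d) (x z : Site d) : trans (shift x ω) 0 z = (ω x).1 z := by
  simp [trans, shift]

lemma exists_ae_tame (μ : Measure (ProbVec d)) [IsProbabilityMeasure μ]
    (hM : ExpMoment (envMeasure μ)) :
    ∃ s A : ℝ, 0 < s ∧ 1 ≤ A ∧ ∀ᵐ ω ∂envMeasure μ, ω ∈ tame d s A := by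
  obtain ⟨M, s, hM0, hs, h⟩ := hM
  refine ⟨s, Real.exp (s * M), hs, Real.one_le_exp (by positivity), ?_⟩
  filter_upwards [ae_forall_shift μ h] with ω hω x F
  obtain ⟨h1, h2⟩ := hω x
  simp only [trans_shift_zero] at h1 h2
  exact (h1.sum_le_tsum F fun z _ => mul_nonneg (Real.exp_pos _).le ((ω x).2.1 z)).trans h2

lemma abs_height_le (u : Site d) : ∃ U : ℝ, 0 < U ∧ ∀ z, |height u z| ≤ U * ‖toVec z‖ := by
  refine ⟨1 + ∑ i, |(u i : ℝ)|, by positivity, fun z => ?_⟩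
  have h1 : height u z = ∑ i, (z i : ℝ) * (u i : ℝ) := by
    simp [height, dotProduct]
  rw [h1]
  calc |∑ i, (z i : ℝ) * (u i : ℝ)| ≤ ∑ i, |(z i : ℝ) * (u i : ℝ)| :=
        Finset.abs_sum_le_sum_abs _ _
    _ ≤ ∑ i, |(u i : ℝ)| * ‖toVec z‖ := by
        refine Finset.sum_le_sum fun i _ => ?_
        rw [abs_mul, mul_comm]
        gcongr
        exact abs_apply_le_norm_toVec z i
    _ ≤ _ := by
        rw [← Finset.sum_mul]
        gcongr
        linarith

lemma exp_neg_le_quadratic (t : ℝ) : Real.exp (-t) ≤ 1 - t + t ^ 2 * Real.exp |t| := by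
  have h := Complex.norm_exp_sub_sum_le_norm_mul_exp ((-t : ℝ) : ℂ) 2
  have h1 : Complex.exp ((-t : ℝ) : ℂ) -
      ∑ m ∈ Finset.range 2, ((-t : ℝ) : ℂ) ^ m / (Nat.factorial m : ℕ) =
      ((Real.exp (-t) - (1 - t) : ℝ) : ℂ) := by
    simp [Finset.sum_range_succ, Nat.factorial]
    ring
  rw [h1, Complex.norm_real, Complex.norm_real, Real.norm_eq_abs, Real.norm_eq_abs, abs_neg,
    sq_abs] at h
  have h2 := (abs_le.1 h).2
  linarith

/-- Expanding `exp (-t z·u)` to second order gives a one-step mean of at most `1 - t δ + t² C A`,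
the exponential moments controlling the remainder. For small `t` the linear gain wins. -/
lemma exists_ae_drifting (μ : Measure (ProbVec d)) [IsProbabilityMeasure μ] (u : Site d)
    (hN : NonNestling (envMeasure μ) u) {s A : ℝ} (hs : 0 < s) (hA : 1 ≤ A)
    (ht : ∀ᵐ ω ∂envMeasure μ, ω ∈ tame d s A) :
    ∃ s' κ : ℝ, 0 < s' ∧ 0 < κ ∧
      ∀ᵐ ω ∂envMeasure μ, ω ∈ drifting u s' (Real.exp (-(4 * κ))) := by
  obtain ⟨δ, hδ, h⟩ := hN
  obtain ⟨U, hU, hUz⟩ := abs_height_le u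
  set C : ℝ := 8 * U ^ 2 / s ^ 2 with hC
  have hC0 : 0 < C := by positivity
  -- The first bound leaves half of the exponential moment for the square of the height; the second
  -- makes the remainder at most half of the gain `t δ`.
  set t : ℝ := min (s / (2 * U)) (δ / (2 * (C * A))) with htdef
  have ht0 : 0 < t := lt_min (by positivity) (by positivity)
  have htU : t * U ≤ s / 2 := by
    have : t ≤ s / (2 * U) := min_le_left _ _
    rw [le_div_iff₀ (by positivity)] at this
    linarith
  have htC : t * (C * A) ≤ δ / 2 := by
    have : t ≤ δ / (2 * (C * A)) := min_le_right _ _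
    rw [le_div_iff₀ (by positivity)] at this
    linarith
  -- The contraction `exp (-t δ / 2)` is written `exp (-4κ)`, so that a rate `κ` per step is left
  -- after the climb by `2b` is paid for.
  refine ⟨t, t * δ / 8, ht0, by positivity, ?_⟩
  filter_upwards [ae_forall_shift μ h, ht] with ω h1 h2
  intro x
  have hdr := h1 x
  simp only [trans_shift_zero] at hdr
  have hp0 : ∀ z, 0 ≤ (ω x).1 z := (ω x).2.1
  have hexp : Summable fun z => Real.exp (s * ‖toVec z‖) * (ω x).1 z :=
    summable_of_sum_le (fun z => mul_nonneg (Real.exp_pos _).le (hp0 z)) (h2 x)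
  have hexpA : ∑' z, Real.exp (s * ‖toVec z‖) * (ω x).1 z ≤ A := hexp.tsum_le_of_sum_le (h2 x)
  have hdrs : Summable fun z => height u z * (ω x).1 z := by
    refine Summable.of_norm_bounded (hexp.mul_left (U / s)) fun z => ?_
    rw [norm_mul, Real.norm_of_nonneg (hp0 z), ← mul_assoc]
    refine mul_le_mul_of_nonneg_right ((hUz z).trans ?_) (hp0 z)
    have := Real.add_one_le_exp (s * ‖toVec z‖)
    calc U * ‖toVec z‖ = U / s * (s * ‖toVec z‖) := by field_simp
      _ ≤ _ := by gcongr; linarith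
  have hpt : ∀ z, (ω x).1 z * Real.exp (-(t * height u z)) ≤
      (ω x).1 z - t * (height u z * (ω x).1 z) +
        t ^ 2 * C * (Real.exp (s * ‖toVec z‖) * (ω x).1 z) := by
    intro z
    have hq := exp_neg_le_quadratic (t * height u z)
    have hz : |t * height u z| ≤ s / 2 * ‖toVec z‖ := by
      rw [abs_mul, abs_of_pos ht0]
      calc t * |height u z| ≤ t * (U * ‖toVec z‖) := by gcongr; exact hUz z
        _ = t * U * ‖toVec z‖ := by ring
        _ ≤ _ := by gcongr
    have hsq : (t * height u z) ^ 2 * Real.exp |t * height u z| ≤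
        t ^ 2 * C * Real.exp (s * ‖toVec z‖) := by
      have h3 := Real.pow_div_factorial_le_exp (s / 2 * ‖toVec z‖) (by positivity) 2
      have h4 : (height u z) ^ 2 ≤ C * Real.exp (s / 2 * ‖toVec z‖) := by
        calc (height u z) ^ 2 = |height u z| ^ 2 := (sq_abs _).symm
          _ ≤ (U * ‖toVec z‖) ^ 2 := by gcongr; exact hUz z
          _ = C * ((s / 2 * ‖toVec z‖) ^ 2 / (Nat.factorial 2 : ℕ)) := by
            simp only [hC, Nat.factorial]
            field_simp
            norm_num
            ring
          _ ≤ _ := by gcongr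
      calc (t * height u z) ^ 2 * Real.exp |t * height u z|
          = t ^ 2 * (height u z) ^ 2 * Real.exp |t * height u z| := by ring
        _ ≤ t ^ 2 * (C * Real.exp (s / 2 * ‖toVec z‖)) * Real.exp (s / 2 * ‖toVec z‖) := by
          gcongr
        _ = t ^ 2 * C * (Real.exp (s / 2 * ‖toVec z‖) * Real.exp (s / 2 * ‖toVec z‖)) := by ring
        _ = _ := by
          rw [← Real.exp_add]
          congr 2
          ring
    calc (ω x).1 z * Real.exp (-(t * height u z))
        ≤ (ω x).1 z * (1 - t * height u z + t ^ 2 * C * Real.exp (s * ‖toVec z‖)) := by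
          refine mul_le_mul_of_nonneg_left ?_ (hp0 z)
          linarith
      _ = _ := by ring
  have hsum := ((ω x).2.2.sub (hdrs.hasSum.mul_left t)).add (hexp.hasSum.mul_left (t ^ 2 * C))
  have hbound : 1 - t * (∑' z, height u z * (ω x).1 z) +
      t ^ 2 * C * ∑' z, Real.exp (s * ‖toVec z‖) * (ω x).1 z ≤ Real.exp (-(4 * (t * δ / 8))) := by
    have h5 := Real.add_one_le_exp (-(4 * (t * δ / 8)))
    have h6 : t * δ ≤ t * (∑' z, height u z * (ω x).1 z) := by
      gcongr
      exact hdr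
    have h7 : t ^ 2 * C * ∑' z, Real.exp (s * ‖toVec z‖) * (ω x).1 z ≤ t * (δ / 2) := by
      calc _ ≤ t ^ 2 * C * A := by gcongr
        _ = t * (t * (C * A)) := by ring
        _ ≤ _ := by gcongr
    linarith
  have horig : ∑' z, ENNReal.ofReal ((ω x).1 z) * ENNReal.ofReal (Real.exp (-(t * height u z))) ≤
      ENNReal.ofReal (Real.exp (-(4 * (t * δ / 8)))) := by
    calc _ ≤ ∑' z, ENNReal.ofReal ((ω x).1 z - t * (height u z * (ω x).1 z) +
        t ^ 2 * C * (Real.exp (s * ‖toVec z‖) * (ω x).1 z)) := by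
          refine ENNReal.tsum_le_tsum fun z => ?_
          rw [← ENNReal.ofReal_mul (hp0 z)]
          exact ENNReal.ofReal_le_ofReal (hpt z)
      _ = ENNReal.ofReal (1 - t * (∑' z, height u z * (ω x).1 z) +
          t ^ 2 * C * ∑' z, Real.exp (s * ‖toVec z‖) * (ω x).1 z) := by
          rw [← ENNReal.ofReal_tsum_of_nonneg (fun z => ?_) hsum.summable, hsum.tsum_eq]
          exact (mul_nonneg (hp0 z) (Real.exp_pos _).le).trans (hpt z)
      _ ≤ _ := ENNReal.ofReal_le_ofReal hbound
  calc _ = ∑' z, ENNReal.ofReal ((ω x).1 z) * ENNReal.ofReal (Real.exp (-(t * height u z))) *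
        ENNReal.ofReal (Real.exp (-(t * height u x))) := by
        simp only [walk, Set.indicator_univ]
        rw [← (Equiv.addRight x).tsum_eq]
        refine tsum_congr fun z => ?_
        simp only [Equiv.coe_addRight, trans, add_sub_cancel_right]
        rw [mul_assoc, ← ENNReal.ofReal_mul (Real.exp_pos _).le, ← Real.exp_add, height_add]
        congr 4
        ring
    _ ≤ _ := by
        rw [ENNReal.tsum_mul_right]
        gcongr

/-! ### The variance bound uniform along the environment process -/

lemma integrable_quenchedMean_sub_sq {s A : ℝ} (hs : 0 < s) (hA : 1 ≤ A) {Q : Measure (Env d)}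
    [IsProbabilityMeasure Q] (ht : ∀ᵐ ω ∂Q, ω ∈ tame d s A) (n : ℕ)
    (a : EuclideanSpace ℝ (Fin d)) :
    Integrable (fun ω => ‖quenchedMean ω n - a‖ ^ 2) Q := by
  refine Integrable.of_bound
    ((((measurable_quenchedMean n).sub_const a).norm.pow_const 2).aestronglyMeasurable)
    ((2 * A / s * n + ‖a‖) ^ 2) (ht.mono fun ω hω => ?_)
  rw [Real.norm_of_nonneg (by positivity)]
  gcongr
  exact (norm_sub_le _ _).trans (add_le_add (norm_quenchedMean_le hs hA hω n) le_rfl)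

lemma integrable_quenchedMean {s A : ℝ} (hs : 0 < s) (hA : 1 ≤ A) {Q : Measure (Env d)}
    [IsProbabilityMeasure Q] (ht : ∀ᵐ ω ∂Q, ω ∈ tame d s A) (n : ℕ) :
    Integrable (fun ω => quenchedMean ω n) Q :=
  Integrable.of_bound (measurable_quenchedMean n).aestronglyMeasurable (2 * A / s * n)
    (ht.mono fun _ hω => norm_quenchedMean_le hs hA hω n)

lemma lintegral_quenchedMean_sub_sq {s A : ℝ} (hs : 0 < s) (hA : 1 ≤ A) {Q : Measure (Env d)}
    [IsProbabilityMeasure Q] (ht : ∀ᵐ ω ∂Q, ω ∈ tame d s A) (n : ℕ)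
    (a : EuclideanSpace ℝ (Fin d)) :
    ∫⁻ ω, ‖quenchedMean ω n - a‖ₑ ^ 2 ∂Q =
      ENNReal.ofReal (∫ ω, ‖quenchedMean ω n - a‖ ^ 2 ∂Q) := by
  rw [ofReal_integral_eq_lintegral_ofReal (integrable_quenchedMean_sub_sq hs hA ht n a)
    (Eventually.of_forall fun ω => by positivity)]
  refine lintegral_congr fun ω => ?_
  rw [← ofReal_norm, ← ENNReal.ofReal_pow (norm_nonneg _)]

lemma norm_averagedMean_le {s A : ℝ} (hs : 0 < s) (hA : 1 ≤ A) {P : Measure (Env d)}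
    [IsProbabilityMeasure P] (ht : ∀ᵐ ω ∂P, ω ∈ tame d s A) (n : ℕ) :
    ‖averagedMean P n‖ ≤ 2 * A / s * n := by
  have := norm_integral_le_of_norm_le_const (μ := P)
    (ht.mono fun _ hω => norm_quenchedMean_le hs hA hω n)
  simpa [averagedMean] using this

/-- The quenched variance of the mean seen from the walker is controlled, uniformly in the time
`m` elapsed, by the one at time `0`. -/
lemma exists_variance_envLaw_le (hd : d ≠ 0) (μ : Measure (ProbVec d)) [IsProbabilityMeasure μ]
    {u : Site d} {s s' A κ : ℝ} (hs : 0 < s) (hs' : 0 < s') (hA : 1 ≤ A) (hκ : 0 < κ)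
    (ht : ∀ᵐ ω ∂envMeasure μ, ω ∈ tame d s A)
    (hdr : ∀ᵐ ω ∂envMeasure μ, ω ∈ drifting u s' (Real.exp (-(4 * κ)))) :
    ∃ C : ℝ, 0 ≤ C ∧ ∀ n k m : ℕ, n ≠ 0 → k ≠ 0 →
      ∫ ω, ‖quenchedMean ω n - averagedMean (envMeasure μ) n‖ ^ 2 ∂envLaw (envMeasure μ) m ≤
        C * (k ^ (2 * d) * (∫ ω, ‖quenchedMean ω n - averagedMean (envMeasure μ) n‖ ^ 2
          ∂envMeasure μ + n ^ 4 * Real.exp (-(κ * k))) + k ^ 2) := by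
  obtain ⟨W, hW0, hW⟩ := tsum_site_exp_le hd hs
  set r : ℝ := Real.exp (-(4 * κ)) with hr
  have hr1 : r < 1 := Real.exp_lt_one_iff.2 (by linarith)
  have hr0 : 0 < r := Real.exp_pos _
  set c : ℝ := (1 - r)⁻¹ with hc
  have hc0 : 0 < c := inv_pos.2 (by linarith)
  have hcE : (1 - ENNReal.ofReal r)⁻¹ = ENNReal.ofReal c := by
    rw [hc, ENNReal.ofReal_inv_of_pos (by linarith), ENNReal.ofReal_sub _ hr0.le,
      ENNReal.ofReal_one]
  set K₁ : ℝ := 2 * A / s with hK₁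
  set K₂ : ℝ := 4 * A / s ^ 2 with hK₂
  have hK₁0 : 0 < K₁ := by positivity
  have hK₂0 : 0 < K₂ := by positivity
  refine ⟨2 * ((2 * K₁) ^ 2 * (1 + c) + 2 * (c + K₂) ^ 2 +
    2 * A * W * (2 * (2 + 2 * (c + K₂) ^ 2))) + 2 * (4 * A / s) ^ 2, by positivity,
    fun n k m hn hk => ?_⟩
  have hn1 : (1 : ℝ) ≤ n := by exact_mod_cast Nat.one_le_iff_ne_zero.2 hn
  have hk1 : (1 : ℝ) ≤ k := by exact_mod_cast Nat.one_le_iff_ne_zero.2 hk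
  set a := averagedMean (envMeasure μ) n with ha
  have haK : ‖a‖ ≤ K₁ * n := norm_averagedMean_le hs hA ht n
  set V : ℝ := ∫ ω, ‖quenchedMean ω n - a‖ ^ 2 ∂envMeasure μ with hV
  have hV0 : 0 ≤ V := integral_nonneg fun ω => by positivity
  set X : ℝ := Real.exp (-(κ * k)) with hX
  have hX0 : 0 < X := Real.exp_pos _
  have hX1 : X ≤ 1 := Real.exp_le_one_iff.2 (by have : 0 ≤ κ * k := by positivity
                                                linarith)
  -- With this `b`, going back by `b` has probability of order `exp (-κ k)`, and failing to climb by
  -- `2b` costs `exp (2κ k - 4κ k)`.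
  set b : ℝ := κ * k / s' with hb
  have hsb : s' * b = κ * k := by rw [hb]; field_simp
  set e : ℝ := (c + K₂) ^ 2 * n ^ 4 * X with he
  have he0 : 0 ≤ e := by positivity
  have h1 : ∀ ω ∈ tame d s A, ω ∈ drifting u s' r →
      ‖quenchedMean ω n - killedMean {z | -b ≤ height u z} ω n‖ₑ ^ 2 ≤ ENNReal.ofReal e := by
    intro ω hω hω'
    -- The truncation level `exp (κ k / 2)` gives both error terms the factor `exp (-κ k / 2)`,
    -- whose square is `X`.
    have h2 := enorm_quenchedMean_sub_killedMean_le hs hs'.le hA hω hω' n b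
      (Real.exp_pos (κ * k / 2))
    rw [hcE, hsb, ← ENNReal.ofReal_mul (Real.exp_pos _).le,
      ← ENNReal.ofReal_mul (Real.exp_pos _).le,
      ← ENNReal.ofReal_add (by positivity) (by positivity)] at h2
    calc _ ≤ _ := pow_le_pow_left' h2 2
      _ ≤ _ := by
        rw [← ENNReal.ofReal_pow (by positivity)]
        refine ENNReal.ofReal_le_ofReal ?_
        have h3 : Real.exp (κ * k / 2) * (X * c) = Real.exp (-(κ * k / 2)) * c := by
          rw [hX, ← mul_assoc, ← Real.exp_add]
          congr 2
          ring
        have h4 : X = Real.exp (-(κ * k / 2)) ^ 2 := by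
          rw [hX, ← Real.exp_nat_mul]
          congr 1
          push_cast
          ring
        have h5 : c ≤ c * (n : ℝ) ^ 2 := le_mul_of_one_le_right hc0.le (one_le_pow₀ hn1)
        rw [← hX, h3, ← Real.exp_neg]
        calc _ = Real.exp (-(κ * k / 2)) ^ 2 * (c + K₂ * n ^ 2) ^ 2 := by ring
          _ ≤ Real.exp (-(κ * k / 2)) ^ 2 * (c * n ^ 2 + K₂ * n ^ 2) ^ 2 := by gcongr
          _ = e := by rw [← h4, he]; ring
  have h2 : ∀ ω ∈ tame d s A, ‖quenchedMean ω n - a‖ₑ ^ 2 ≤ ENNReal.ofReal ((2 * K₁ * n) ^ 2) := by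
    intro ω hω
    rw [← ofReal_norm, ← ENNReal.ofReal_pow (norm_nonneg _)]
    refine ENNReal.ofReal_le_ofReal ?_
    gcongr
    calc _ ≤ _ := norm_sub_le _ _
      _ ≤ K₁ * n + K₁ * n := add_le_add (norm_quenchedMean_le hs hA hω n) haK
      _ = _ := by ring
  have h3 := lintegral_envLaw_add_quenchedMean_le μ hs hs'.le hA ht hdr b hk m n h2 h1
  have h4 := lintegral_envLaw_le_add hs hA ht m k n a
  have hm : ∀ᵐ ω ∂envLaw (envMeasure μ) m, ω ∈ tame d s A :=
    ae_envLaw_mem (measurableSet_tame s A) (fun ω hω z => shift_mem_tame hω z) ht m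
  rw [lintegral_quenchedMean_sub_sq hs hA hm] at h4
  rw [lintegral_quenchedMean_sub_sq hs hA ht, ← hV, hcE] at h3
  have hexp1 : ENNReal.ofReal (Real.exp (s' * (2 * b))) * ENNReal.ofReal r ^ k ≤
      ENNReal.ofReal X := by
    rw [← ENNReal.ofReal_pow hr0.le, ← ENNReal.ofReal_mul (Real.exp_pos _).le]
    refine ENNReal.ofReal_le_ofReal ?_
    rw [hr, ← Real.exp_nat_mul, ← Real.exp_add, hX]
    refine Real.exp_le_exp.2 ?_
    have : 0 ≤ κ * k := by positivity
    linarith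
  have h5 : ∫⁻ ω, ‖quenchedMean ω n - a‖ₑ ^ 2 ∂envLaw (envMeasure μ) (m + k) ≤
      ENNReal.ofReal ((2 * K₁ * n) ^ 2 * X + (2 * K₁ * n) ^ 2 * (X * c) + 2 * e +
        2 * A * (W * k ^ (2 * d)) * (2 * (2 * V + 2 * e))) := by
    refine h3.trans ?_
    rw [ENNReal.ofReal_add (by positivity) (by positivity),
      ENNReal.ofReal_add (by positivity) (by positivity),
      ENNReal.ofReal_add (by positivity) (by positivity),
      ENNReal.ofReal_mul (p := (2 * K₁ * n) ^ 2) (by positivity),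
      ENNReal.ofReal_mul (p := (2 * K₁ * n) ^ 2) (by positivity),
      ENNReal.ofReal_mul (p := X) (by positivity), ENNReal.ofReal_mul (q := e) (by positivity),
      ENNReal.ofReal_mul (p := 2 * A * (W * k ^ (2 * d))) (by positivity),
      ENNReal.ofReal_mul (p := 2 * A) (by positivity),
      ENNReal.ofReal_mul (q := 2 * V + 2 * e) (by positivity),
      ENNReal.ofReal_add (p := 2 * V) (by positivity) (by positivity),
      ENNReal.ofReal_mul (q := V) (by positivity), ENNReal.ofReal_mul (q := e) (by positivity),
      show ENNReal.ofReal 2 = 2 by simp, hsb]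
    gcongr
    exact hW k hk
  have hadd : ∀ p q : ℝ, 0 ≤ p → 0 ≤ q →
      2 * ENNReal.ofReal p + 2 * ENNReal.ofReal q = ENNReal.ofReal (2 * p + 2 * q) := by
    intro p q hp hq
    rw [ENNReal.ofReal_add (by positivity) (by positivity),
      ENNReal.ofReal_mul (p := 2) (by norm_num), ENNReal.ofReal_mul (p := 2) (by norm_num),
      show ENNReal.ofReal 2 = 2 by simp]
  have h6 : ∫ ω, ‖quenchedMean ω n - a‖ ^ 2 ∂envLaw (envMeasure μ) m ≤
      2 * ((2 * K₁ * n) ^ 2 * X + (2 * K₁ * n) ^ 2 * (X * c) + 2 * e +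
        2 * A * (W * k ^ (2 * d)) * (2 * (2 * V + 2 * e))) + 2 * (4 * A / s * k) ^ 2 := by
    rw [← ENNReal.ofReal_le_ofReal_iff (by positivity)]
    exact (h4.trans (add_le_add (mul_le_mul_right h5 2) le_rfl)).trans
      (hadd _ _ (by positivity) (by positivity)).le
  refine h6.trans ?_
  set Y : ℝ := n ^ 4 * X with hY
  have hY0 : 0 ≤ Y := by positivity
  have hkd : (1 : ℝ) ≤ k ^ (2 * d) := one_le_pow₀ hk1
  have hn24 : (n : ℝ) ^ 2 ≤ n ^ 4 := pow_le_pow_right₀ hn1 (by norm_num)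
  have hYY : (n : ℝ) ^ 2 * X ≤ Y :=
    mul_le_mul_of_nonneg_right hn24 hX0.le
  have heY : e = (c + K₂) ^ 2 * Y := by rw [he, hY]; ring
  set D : ℝ := (k : ℝ) ^ (2 * d) with hD
  -- Since `k ≥ 1`, every term except the `k²` one is absorbed into `D * (V + Y)`.
  have hZ : Y ≤ D * (V + Y) := by
    calc Y ≤ 1 * (V + Y) := by linarith
      _ ≤ _ := by gcongr
  calc _ = 2 * ((2 * K₁) ^ 2 * (1 + c) * (n ^ 2 * X) + 2 * (c + K₂) ^ 2 * Y +
        2 * A * W * (2 * (2 * (D * V) + 2 * (c + K₂) ^ 2 * (D * Y)))) +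
        2 * (4 * A / s) ^ 2 * k ^ 2 := by rw [heY]; ring
    _ ≤ 2 * ((2 * K₁) ^ 2 * (1 + c) * (D * (V + Y)) + 2 * (c + K₂) ^ 2 * (D * (V + Y)) +
        2 * A * W * (2 * (2 * (D * (V + Y)) + 2 * (c + K₂) ^ 2 * (D * (V + Y))))) +
        2 * (4 * A / s) ^ 2 * k ^ 2 := by
        have hD0 : 0 ≤ D := by linarith
        have hDV : D * V ≤ D * (V + Y) := by gcongr; linarith
        have hDY : D * Y ≤ D * (V + Y) := by gcongr; linarith
        have := hYY.trans hZ
        gcongr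
    _ = (2 * ((2 * K₁) ^ 2 * (1 + c) + 2 * (c + K₂) ^ 2 +
        2 * A * W * (2 * (2 + 2 * (c + K₂) ^ 2)))) * (D * (V + Y)) +
        2 * (4 * A / s) ^ 2 * k ^ 2 := by ring
    _ ≤ _ := by
        have hk2 : (0 : ℝ) ≤ k ^ 2 := by positivity
        have hDD : 0 ≤ D * (V + Y) := hY0.trans hZ
        have key : ∀ p q z w : ℝ, 0 ≤ p → 0 ≤ q → 0 ≤ z → 0 ≤ w →
            p * z + q * w ≤ (p + q) * (z + w) := fun p q z w hp hq hz hw => by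
          nlinarith [mul_nonneg hp hw, mul_nonneg hq hz]
        exact key _ _ _ _ (by positivity) (by positivity) hDD hk2

/-! ### Existence of limit measures -/

/-- Domination by a summable profile prevents mass from escaping to infinity: on the compact product
of intervals the total mass is continuous, so total mass one is a closed condition. -/
lemma isCompact_probVec (hd : d ≠ 0) {s : ℝ} (hs : 0 < s) (A : ℝ) :
    IsCompact {p : ProbVec d | ∀ z, p.1 z ≤ A * Real.exp (-(s * ‖toVec z‖))} := by
  have hind : IsInducing (Subtype.val : ProbVec d → Site d → ℝ) := IsInducing.subtypeVal
  rw [hind.isCompact_iff]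
  set K : Set (Site d → ℝ) :=
    Set.pi Set.univ fun z => Set.Icc 0 (A * Real.exp (-(s * ‖toVec z‖))) with hK
  have hKc : IsCompact K := isCompact_univ_pi fun _ => isCompact_Icc
  have hsum : Summable fun z : Site d => A * Real.exp (-(s * ‖toVec z‖)) :=
    (summable_exp_neg_norm hd hs).mul_left A
  have hcont : ContinuousOn (fun p : Site d → ℝ => ∑' z, p z) K := by
    refine continuousOn_tsum (fun z => (continuous_apply z).continuousOn) hsum fun z p hp => ?_
    have := hp z (Set.mem_univ z)
    rw [Real.norm_of_nonneg this.1]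
    exact this.2
  have hclosed : IsClosed (K ∩ (fun p : Site d → ℝ => ∑' z, p z) ⁻¹' {1}) :=
    hcont.preimage_isClosed_of_isClosed hKc.isClosed isClosed_singleton
  convert! hKc.of_isClosed_subset hclosed Set.inter_subset_left using 1
  ext p
  constructor
  swap
  · rintro ⟨hp, h1⟩
    have hps : Summable p := Summable.of_nonneg_of_le (fun z => (hp z (Set.mem_univ z)).1)
      (fun z => (hp z (Set.mem_univ z)).2) hsum
    refine ⟨⟨p, fun z => (hp z (Set.mem_univ z)).1, ?_⟩, fun z => (hp z (Set.mem_univ z)).2, rfl⟩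
    rw [← (show ∑' z, p z = 1 from h1)]
    exact hps.hasSum
  · rintro ⟨q, hq, rfl⟩
    exact ⟨fun z _ => ⟨q.2.1 z, hq z⟩, q.2.2.tsum_eq⟩

/-- Prokhorov: all the Cesàro averages are carried by one compact product of compact simplices. The
averages start at `N = 1` to be probability measures. -/
lemma exists_isEnvLimit (hd : d ≠ 0) {s A : ℝ} (hs : 0 < s) {P : Measure (Env d)}
    [IsProbabilityMeasure P] (ht : ∀ᵐ ω ∂P, ω ∈ tame d s A) :
    ∃ Pinf : Measure (Env d), IsEnvLimit P Pinf := by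
  set K : Set (Env d) := Set.pi Set.univ fun _ =>
    {p : ProbVec d | ∀ z, p.1 z ≤ A * Real.exp (-(s * ‖toVec z‖))} with hK
  have hKc : IsCompact K := isCompact_univ_pi fun _ => isCompact_probVec hd hs A
  have hsub : tame d s A ⊆ K := fun ω hω x _ z => tame_trans_le hω x z
  let Q : ℕ → ProbabilityMeasure (Env d) := fun j =>
    ⟨avgLaw P (j + 1), isProbabilityMeasure_avgLaw P (Nat.succ_ne_zero j)⟩
  have htight : IsTightMeasureSet {((ν : ProbabilityMeasure (Env d)) : Measure (Env d)) |
      ν ∈ Set.range Q} := by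
    rw [isTightMeasureSet_iff_exists_isCompact_measure_compl_le]
    refine fun ε _ => ⟨K, hKc, ?_⟩
    rintro _ ⟨_, ⟨j, rfl⟩, rfl⟩
    have h1 : ∀ᵐ ω ∂avgLaw P (j + 1), ω ∈ K :=
      (ae_avgLaw_mem (measurableSet_tame s A) (fun ω hω z => shift_mem_tame hω z) ht (j + 1)).mono
        fun ω hω => hsub hω
    exact (le_of_eq (ae_iff.1 h1)).trans zero_le
  obtain ⟨ν, -, φ, hφ, hlim⟩ := (isCompact_closure_of_isTightMeasureSet htight).tendsto_subseq
    (x := Q) fun j => subset_closure ⟨j, rfl⟩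
  refine ⟨ν, inferInstance, fun j => φ j + 1, fun i j hij => Nat.succ_lt_succ (hφ hij), fun F => ?_⟩
  have := ProbabilityMeasure.tendsto_iff_forall_integral_tendsto.1 hlim F
  refine this.congr fun j => ?_
  rw [← integral_avgLaw_bcf]
  rfl

/-! ### Mean and variance under a limit measure -/

/-- The increments of the averaged mean are means under the laws of the environment seen from
the walker. -/
lemma integral_quenchedMean_envLaw {s A : ℝ} (hs : 0 < s) (hA : 1 ≤ A) {P : Measure (Env d)}
    [IsProbabilityMeasure P] (ht : ∀ᵐ ω ∂P, ω ∈ tame d s A) (m n : ℕ) :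
    ∫ ω, quenchedMean ω n ∂envLaw P m = averagedMean P (m + n) - averagedMean P m := by
  have hm : ∀ᵐ ω ∂envLaw P m, ω ∈ tame d s A :=
    ae_envLaw_mem (measurableSet_tame s A) (fun ω hω z => shift_mem_tame hω z) ht m
  rw [integral_envLaw P m (measurable_quenchedMean n).stronglyMeasurable
    (integrable_quenchedMean hs hA hm n), averagedMean, averagedMean,
    ← integral_sub (integrable_quenchedMean hs hA ht _) (integrable_quenchedMean hs hA ht _)]
  refine integral_congr_ae ?_
  filter_upwards [ht] with ω hω
  rw [quenchedMean_add hs hA hω, add_sub_cancel_left]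

/-- Sums of increments telescope, so raising `n` by one changes the difference only by boundary
terms of norm at most `2 K n`. The bound is free of `N` and disappears in the Cesàro limit. -/
lemma norm_sum_increments_sub_le {E : Type*} [NormedAddCommGroup E] [NormedSpace ℝ E]
    {a : ℕ → E} {K : ℝ} (hK : ∀ m n, ‖a (m + n) - a m‖ ≤ K * n) (n N : ℕ) :
    ‖∑ m ∈ Finset.Icc 1 N, (a (m + n) - a m) -
      (n : ℝ) • ∑ m ∈ Finset.Icc 1 N, (a (m + 1) - a m)‖ ≤ 2 * K * n ^ 2 := by
  have hK0 : 0 ≤ K := by simpa using (norm_nonneg _).trans (hK 0 1)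
  induction n with
  | zero => simp
  | succ n ih =>
    have htel : ∀ i, ∑ m ∈ Finset.Icc 1 N, (a (m + i + 1) - a (m + i)) =
        a (N + 1 + i) - a (1 + i) := by
      intro i
      clear ih
      induction N with
      | zero => simp
      | succ N ihN =>
        rw [Finset.sum_Icc_succ_top (by omega), ihN]
        rw [show N + 1 + i + 1 = N + 1 + 1 + i by ring]
        abel
    have h0 := htel 0
    simp only [add_zero] at h0
    have hsplit : ∑ m ∈ Finset.Icc 1 N, (a (m + (n + 1)) - a m) -
        ((n + 1 : ℕ) : ℝ) • ∑ m ∈ Finset.Icc 1 N, (a (m + 1) - a m) =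
        (∑ m ∈ Finset.Icc 1 N, (a (m + n) - a m) -
          (n : ℝ) • ∑ m ∈ Finset.Icc 1 N, (a (m + 1) - a m)) +
        ((a (N + 1 + n) - a (N + 1)) - (a (1 + n) - a 1)) := by
      have h1 : ∑ m ∈ Finset.Icc 1 N, (a (m + (n + 1)) - a m) =
          ∑ m ∈ Finset.Icc 1 N, (a (m + n) - a m) + (a (N + 1 + n) - a (1 + n)) := by
        rw [← htel n, ← Finset.sum_add_distrib]
        refine Finset.sum_congr rfl fun m _ => ?_
        rw [← add_assoc]
        abel
      rw [h1, Nat.cast_succ, add_smul, one_smul, h0]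
      abel
    rw [hsplit]
    calc _ ≤ 2 * K * n ^ 2 + (K * n + K * n) :=
          (norm_add_le _ _).trans (add_le_add ih ((norm_sub_le _ _).trans
            (add_le_add (hK _ _) (hK _ _))))
      _ ≤ _ := by
          push_cast
          nlinarith [mul_nonneg hK0 (Nat.cast_nonneg (α := ℝ) n)]

/-- The subsequence may begin with `0`, where the average is not a probability measure; dropping its
first term avoids this. -/
lemma exists_avgLaw_tendsto {P Pinf : Measure (Env d)} [IsProbabilityMeasure P]
    (h : IsEnvLimit P Pinf) : ∃ N : ℕ → ℕ, (∀ j, N j ≠ 0) ∧ Tendsto N atTop atTop ∧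
      ∀ F : Env d →ᵇ ℝ, Tendsto (fun j => ∫ ω, F ω ∂avgLaw P (N j)) atTop
        (𝓝 (∫ ω, F ω ∂Pinf)) := by
  obtain ⟨n, hn, hF⟩ := h.tendsto
  refine ⟨fun j => n (j + 1), fun j => ?_, hn.tendsto_atTop.comp (tendsto_add_atTop_nat 1),
    fun F => ?_⟩
  · exact (Nat.zero_le _).trans_lt (hn (Nat.lt_succ_self j)) |>.ne'
  · simp only [integral_avgLaw_bcf]
    exact (hF F).comp (tendsto_add_atTop_nat 1)

/-- Under a limit of the environment process the mean of `X_n` is `n` times the mean drift. -/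
lemma integral_quenchedMean_of_isEnvLimit (hd : d ≠ 0) {s A : ℝ} (hs : 0 < s) (hA : 1 ≤ A)
    {P Pinf : Measure (Env d)} [IsProbabilityMeasure P] (ht : ∀ᵐ ω ∂P, ω ∈ tame d s A)
    (h : IsEnvLimit P Pinf) (n : ℕ) :
    ∫ ω, quenchedMean ω n ∂Pinf = (n : ℝ) • ∫ ω, drift ω ∂Pinf := by
  have := h.isProb
  obtain ⟨N, hN0, hN, hF⟩ := exists_avgLaw_tendsto h
  have hQ : ∀ j, IsProbabilityMeasure (avgLaw P (N j)) := fun j =>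
    isProbabilityMeasure_avgLaw P (hN0 j)
  have hQt : ∀ j, ∀ᵐ ω ∂avgLaw P (N j), ω ∈ tame d s A := fun j =>
    ae_avgLaw_mem (measurableSet_tame s A) (fun ω hω z => shift_mem_tame hω z) ht (N j)
  have hm : ∀ m, ∀ᵐ ω ∂envLaw P m, ω ∈ tame d s A :=
    ae_envLaw_mem (measurableSet_tame s A) (fun ω hω z => shift_mem_tame hω z) ht
  have hlim : ∀ i : ℕ, Tendsto (fun j => ∫ ω, quenchedMean ω i ∂avgLaw P (N j)) atTop
      (𝓝 (∫ ω, quenchedMean ω i ∂Pinf)) := fun i =>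
    tendsto_integral_of_continuousOn_euclidean hQ hF (isClosed_tame s A) hQt
      (continuousOn_quenchedMean hd hs hA i) fun ω hω => norm_quenchedMean_le hs hA hω i
  have heq : ∀ i j, ∫ ω, quenchedMean ω i ∂avgLaw P (N j) = (N j : ℝ)⁻¹ •
      ∑ m ∈ Finset.Icc 1 (N j), (averagedMean P (m + i) - averagedMean P m) := by
    intro i j
    rw [integral_avgLaw P (N j) fun m => integrable_quenchedMean hs hA (hm m) i]
    simp only [integral_quenchedMean_envLaw hs hA ht]
  have hinc : ∀ m i, ‖averagedMean P (m + i) - averagedMean P m‖ ≤ 2 * A / s * i := by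
    intro m i
    rw [← integral_quenchedMean_envLaw hs hA ht]
    have := norm_integral_le_of_norm_le_const (μ := envLaw P m)
      ((hm m).mono fun _ hω => norm_quenchedMean_le hs hA hω i)
    simpa using this
  have hdiff : Tendsto (fun j => ∫ ω, quenchedMean ω n ∂avgLaw P (N j) -
      (n : ℝ) • ∫ ω, quenchedMean ω 1 ∂avgLaw P (N j)) atTop (𝓝 0) := by
    have hz : Tendsto (fun j => (N j : ℝ)⁻¹ * (2 * (2 * A / s) * n ^ 2)) atTop (𝓝 0) := by
      have := (tendsto_inv_atTop_nhds_zero_nat (𝕜 := ℝ)).comp hN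
      simpa using this.mul_const (2 * (2 * A / s) * (n : ℝ) ^ 2)
    refine squeeze_zero_norm (fun j => ?_) hz
    rw [heq, heq, smul_comm, ← smul_sub, norm_smul, Real.norm_of_nonneg (by positivity)]
    gcongr
    exact norm_sum_increments_sub_le hinc n (N j)
  have hconv := (hlim n).sub ((hlim 1).const_smul (n : ℝ))
  exact sub_eq_zero.1 (tendsto_nhds_unique hconv hdiff)

/-- A variance bound uniform along the environment process passes to its limits. -/
lemma integral_isEnvLimit_le (hd : d ≠ 0) {s A : ℝ} (hs : 0 < s) (hA : 1 ≤ A)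
    {P Pinf : Measure (Env d)} [IsProbabilityMeasure P] (ht : ∀ᵐ ω ∂P, ω ∈ tame d s A)
    (h : IsEnvLimit P Pinf) (n : ℕ) (a : EuclideanSpace ℝ (Fin d)) {C : ℝ}
    (hC : ∀ m, ∫ ω, ‖quenchedMean ω n - a‖ ^ 2 ∂envLaw P m ≤ C) :
    ∫ ω, ‖quenchedMean ω n - a‖ ^ 2 ∂Pinf ≤ C := by
  have := h.isProb
  obtain ⟨N, hN0, hN, hF⟩ := exists_avgLaw_tendsto h
  have hQ : ∀ j, IsProbabilityMeasure (avgLaw P (N j)) := fun j =>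
    isProbabilityMeasure_avgLaw P (hN0 j)
  have hQt : ∀ j, ∀ᵐ ω ∂avgLaw P (N j), ω ∈ tame d s A := fun j =>
    ae_avgLaw_mem (measurableSet_tame s A) (fun ω hω z => shift_mem_tame hω z) ht (N j)
  have hm : ∀ m, ∀ᵐ ω ∂envLaw P m, ω ∈ tame d s A :=
    ae_envLaw_mem (measurableSet_tame s A) (fun ω hω z => shift_mem_tame hω z) ht
  have hlim : Tendsto (fun j => ∫ ω, ‖quenchedMean ω n - a‖ ^ 2 ∂avgLaw P (N j)) atTop
      (𝓝 (∫ ω, ‖quenchedMean ω n - a‖ ^ 2 ∂Pinf)) := by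
    refine tendsto_integral_of_continuousOn hQ hF (isClosed_tame s A) hQt
      (((continuousOn_quenchedMean hd hs hA n).sub
        (continuousOn_const (c := a))).norm.pow 2) (C := (2 * A / s * n + ‖a‖) ^ 2) fun ω hω => ?_
    rw [abs_of_nonneg (by positivity)]
    gcongr
    exact (norm_sub_le _ _).trans (add_le_add (norm_quenchedMean_le hs hA hω n) le_rfl)
  refine le_of_tendsto' hlim fun j => ?_
  rw [integral_avgLaw P (N j) fun m => integrable_quenchedMean_sub_sq hs hA (hm m) n a, smul_eq_mul]
  have hNj : (0 : ℝ) < N j := by exact_mod_cast Nat.pos_of_ne_zero (hN0 j)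
  rw [inv_mul_le_iff₀ hNj]
  refine (Finset.sum_le_sum fun m _ => hC m).trans ?_
  simp

lemma ae_tame_of_isEnvLimit {s A : ℝ} {P Pinf : Measure (Env d)} [IsProbabilityMeasure P]
    (ht : ∀ᵐ ω ∂P, ω ∈ tame d s A) (h : IsEnvLimit P Pinf) : ∀ᵐ ω ∂Pinf, ω ∈ tame d s A := by
  have := h.isProb
  obtain ⟨N, hN0, -, hF⟩ := exists_avgLaw_tendsto h
  exact ae_mem_of_tendsto (fun j => isProbabilityMeasure_avgLaw P (hN0 j)) hF (isClosed_tame s A)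
    fun j => ae_avgLaw_mem (measurableSet_tame s A) (fun ω hω z => shift_mem_tame hω z) ht (N j)

/-- The cross term integrates to zero, so recentring at the mean only decreases the second moment.
This exchanges the averaged mean for the limiting one without comparing the two. -/
lemma integral_norm_sub_integral_sq_le {Ω : Type*} [MeasurableSpace Ω] {Q : Measure Ω}
    [IsProbabilityMeasure Q] {f : Ω → EuclideanSpace ℝ (Fin d)} (a : EuclideanSpace ℝ (Fin d))
    (hf : Integrable f Q) (hf2 : ∀ a, Integrable (fun ω => ‖f ω - a‖ ^ 2) Q) :
    ∫ ω, ‖f ω - ∫ ω', f ω' ∂Q‖ ^ 2 ∂Q ≤ ∫ ω, ‖f ω - a‖ ^ 2 ∂Q := by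
  set v := ∫ ω', f ω' ∂Q with hv
  have hpt : ∀ ω, ‖f ω - a‖ ^ 2 =
      ‖f ω - v‖ ^ 2 + 2 * inner ℝ (v - a) (f ω - v) + ‖v - a‖ ^ 2 := by
    intro ω
    rw [show f ω - a = (f ω - v) + (v - a) by abel, norm_add_sq_real, real_inner_comm]
  have hfv : Integrable (fun ω => f ω - v) Q := hf.sub (integrable_const v)
  have hi : Integrable (fun ω => inner ℝ (v - a) (f ω - v)) Q := hfv.const_inner (v - a)
  have hi2 : Integrable (fun ω => ‖f ω - v‖ ^ 2 + 2 * inner ℝ (v - a) (f ω - v)) Q :=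
    (hf2 v).add (hi.const_mul 2)
  have hz : ∫ ω, inner ℝ (v - a) (f ω - v) ∂Q = 0 := by
    rw [integral_inner hfv, integral_sub hf (integrable_const v)]
    simp [← hv]
  simp only [hpt]
  rw [integral_add hi2 (integrable_const _),
    integral_add (hf2 v) (hi.const_mul 2), integral_const_mul, hz]
  simp

/-! ### Choice of the gap and conclusion -/

/-- Optimizing the number of steps: `k = ⌈n ^ ε⌉`. -/
lemma exists_pow_bound {κ ε β C₁ C₂ : ℝ} (p : ℕ) (hκ : 0 < κ) (hε : 0 < ε) (hβ : 0 ≤ β)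
    (hC₁ : 0 ≤ C₁) (hC₂ : 0 ≤ C₂) :
    ∃ C : ℝ, ∀ n : ℕ, n ≠ 0 → ∃ k : ℕ, k ≠ 0 ∧ ∀ V : ℝ, V ≤ C₂ * (n : ℝ) ^ (2 * β) →
      C₁ * ((k : ℝ) ^ p * (V + n ^ 4 * Real.exp (-(κ * k))) + k ^ 2) ≤
        C * (n : ℝ) ^ (2 * β + ε * (p + 2)) := by
  -- The least power with `ε q ≥ 4`, so that the term of order `q` of `exp (κ n ^ ε)` dominates
  -- `n⁴`.
  set q : ℕ := ⌈4 / ε⌉₊ with hq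
  set D : ℝ := (Nat.factorial q : ℕ) / κ ^ q with hD
  have hD0 : 0 ≤ D := by positivity
  refine ⟨C₁ * (2 ^ p * (C₂ + D) + 4), fun n hn => ⟨⌈(n : ℝ) ^ ε⌉₊, ?_, fun V hV => ?_⟩⟩
  · have : (0 : ℝ) < (n : ℝ) ^ ε := by positivity
    exact (Nat.ceil_pos.2 this).ne'
  have hn1 : (1 : ℝ) ≤ n := by exact_mod_cast Nat.one_le_iff_ne_zero.2 hn
  have hn0 : (0 : ℝ) ≤ n := by linarith
  have hnp : (0 : ℝ) < n := by linarith
  set k : ℕ := ⌈(n : ℝ) ^ ε⌉₊ with hk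
  have hne1 : (1 : ℝ) ≤ (n : ℝ) ^ ε := Real.one_le_rpow hn1 hε.le
  have hkl : (n : ℝ) ^ ε ≤ k := Nat.le_ceil _
  have hku : (k : ℝ) ≤ 2 * (n : ℝ) ^ ε := by
    have := (Nat.ceil_lt_add_one (by positivity : 0 ≤ (n : ℝ) ^ ε)).le
    linarith
  have hexp : (n : ℝ) ^ 4 * Real.exp (-(κ * k)) ≤ D := by
    have h1 : (κ * (n : ℝ) ^ ε) ^ q / (Nat.factorial q : ℕ) ≤ Real.exp (κ * k) :=
      (Real.pow_div_factorial_le_exp _ (by positivity) q).trans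
        (Real.exp_le_exp.2 (by gcongr))
    have h2 : (n : ℝ) ^ 4 ≤ ((n : ℝ) ^ ε) ^ q := by
      rw [← Real.rpow_natCast (n : ℝ) 4, ← Real.rpow_natCast ((n : ℝ) ^ ε) q, ← Real.rpow_mul hn0]
      refine Real.rpow_le_rpow_of_exponent_le hn1 ?_
      have : 4 / ε ≤ q := Nat.le_ceil _
      rw [div_le_iff₀ hε] at this
      push_cast
      linarith
    rw [Real.exp_neg, ← div_eq_mul_inv, div_le_iff₀ (Real.exp_pos _)]
    calc (n : ℝ) ^ 4 ≤ ((n : ℝ) ^ ε) ^ q := h2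
      _ = D * ((κ * (n : ℝ) ^ ε) ^ q / (Nat.factorial q : ℕ)) := by
          rw [hD, mul_pow]
          have : ((Nat.factorial q : ℕ) : ℝ) ≠ 0 := by positivity
          field_simp
      _ ≤ _ := by gcongr
  have hpow : ∀ j : ℕ, (k : ℝ) ^ j ≤ 2 ^ j * (n : ℝ) ^ (ε * j) := by
    intro j
    calc (k : ℝ) ^ j ≤ (2 * (n : ℝ) ^ ε) ^ j := by gcongr
      _ = _ := by rw [mul_pow, Real.rpow_mul hn0, Real.rpow_natCast]
  have hb1 : (1 : ℝ) ≤ (n : ℝ) ^ (2 * β) := Real.one_le_rpow hn1 (by positivity)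
  have hT : 0 < (n : ℝ) ^ (2 * β + ε * (p + 2)) := by positivity
  have hs1 : (k : ℝ) ^ p * (V + n ^ 4 * Real.exp (-(κ * k))) ≤
      2 ^ p * (C₂ + D) * (n : ℝ) ^ (2 * β + ε * (p + 2)) := by
    calc (k : ℝ) ^ p * (V + n ^ 4 * Real.exp (-(κ * k)))
        ≤ (k : ℝ) ^ p * ((C₂ + D) * (n : ℝ) ^ (2 * β)) := by
          gcongr
          have : D ≤ D * (n : ℝ) ^ (2 * β) := le_mul_of_one_le_right hD0 hb1
          linarith
      _ ≤ (2 ^ p * (n : ℝ) ^ (ε * p)) * ((C₂ + D) * (n : ℝ) ^ (2 * β)) := by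
          gcongr
          exact hpow p
      _ = 2 ^ p * (C₂ + D) * (n : ℝ) ^ (2 * β + ε * p) := by
          rw [Real.rpow_add hnp]
          ring
      _ ≤ _ := by
          gcongr
          linarith
  have hs2 : (k : ℝ) ^ 2 ≤ 4 * (n : ℝ) ^ (2 * β + ε * (p + 2)) := by
    refine (hpow 2).trans ?_
    norm_num
    refine Real.rpow_le_rpow_of_exponent_le hn1 ?_
    have : 0 ≤ ε * p := by positivity
    linarith
  calc _ ≤ C₁ * (2 ^ p * (C₂ + D) * (n : ℝ) ^ (2 * β + ε * (p + 2)) +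
        4 * (n : ℝ) ^ (2 * β + ε * (p + 2))) := by gcongr
    _ = _ := by ring

end RWRE

end

theorem proposition5p2 {d : ℕ} (μ : Measure (RWRE.ProbVec d)) [IsProbabilityMeasure μ]
    (u : RWRE.Site d) (hu : u ≠ 0)
    (hN : RWRE.NonNestling (RWRE.envMeasure μ) u)
    (hM : RWRE.ExpMoment (RWRE.envMeasure μ))
    (αbar : ℝ) (hαbar : αbar < 1 / 2)
    (hvar : (fun n : ℕ => ∫ ω, ‖RWRE.quenchedMean ω n -
          RWRE.averagedMean (RWRE.envMeasure μ) n‖ ^ 2 ∂(RWRE.envMeasure μ))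
        =O[atTop] fun n : ℕ => (n : ℝ) ^ (2 * αbar)) :
    (∃ Pinf : Measure (RWRE.Env d), RWRE.IsEnvLimit (RWRE.envMeasure μ) Pinf) ∧
    ∀ Pinf : Measure (RWRE.Env d), RWRE.IsEnvLimit (RWRE.envMeasure μ) Pinf →
      Integrable RWRE.drift Pinf ∧
      (∀ n : ℕ,
        (∀ᵐ ω ∂Pinf, Integrable (fun X : ℕ → RWRE.Site d => RWRE.toVec (X n))
          (RWRE.quenched ω 0)) ∧
        Integrable (fun ω => ‖RWRE.quenchedMean ω n -
          (n : ℝ) • ∫ ω', RWRE.drift ω' ∂Pinf‖ ^ 2) Pinf) ∧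
      ∃ α : ℝ, α < 1 / 2 ∧
        (fun n : ℕ => ∫ ω, ‖RWRE.quenchedMean ω n -
            (n : ℝ) • ∫ ω', RWRE.drift ω' ∂Pinf‖ ^ 2 ∂Pinf)
          =O[atTop] fun n : ℕ => (n : ℝ) ^ (2 * α) := by
  have hd : d ≠ 0 := by
    rintro rfl
    exact hu (Subsingleton.elim _ _)
  obtain ⟨s, A, hs, hA, ht⟩ := RWRE.exists_ae_tame μ hM
  refine ⟨RWRE.exists_isEnvLimit hd hs ht, fun Pinf hP => ?_⟩
  have := hP.isProb
  have htP := RWRE.ae_tame_of_isEnvLimit ht hP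
  refine ⟨RWRE.integrable_quenchedMean hs hA htP 1, fun n =>
    ⟨htP.mono fun ω hω => RWRE.integrable_toVec_quenched hs hA hω n 0,
      RWRE.integrable_quenchedMean_sub_sq hs hA htP n _⟩, ?_⟩
  obtain ⟨s', κ, hs', hκ, hdr⟩ := RWRE.exists_ae_drifting μ u hN hs hA ht
  obtain ⟨C₁, hC₁, hvarm⟩ := RWRE.exists_variance_envLaw_le hd μ hs hs' hA hκ ht hdr
  obtain ⟨C₂, hC₂, hC₂b⟩ := hvar.exists_nonneg
  -- A nonnegative exponent lets the bounded error terms be absorbed into `n ^ (2 * β)`.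
  set β : ℝ := max αbar 0 with hβ
  have hβ0 : 0 ≤ β := le_max_right _ _
  have hβ1 : β < 1 / 2 := max_lt hαbar (by norm_num)
  -- The loss `ε (2d + 2)` in the exponent then uses exactly half of the gap `1 - 2β`.
  set ε : ℝ := (1 - 2 * β) / (2 * ((2 * d : ℕ) + 2)) with hε
  have hε0 : 0 < ε := div_pos (by linarith) (by positivity)
  have hεe : ε * ((2 * d : ℕ) + 2) = (1 - 2 * β) / 2 := by
    rw [hε]
    field_simp
  obtain ⟨C, hC⟩ := RWRE.exists_pow_bound (2 * d) hκ hε0 hβ0 hC₁ hC₂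
  refine ⟨β + (1 - 2 * β) / 4, by linarith, Asymptotics.IsBigO.of_bound C ?_⟩
  filter_upwards [hC₂b.bound, eventually_ne_atTop 0] with n hn hn0
  have hn1 : (1 : ℝ) ≤ n := by exact_mod_cast Nat.one_le_iff_ne_zero.2 hn0
  obtain ⟨k, hk0, hk⟩ := hC n hn0
  have hV : ∫ ω, ‖RWRE.quenchedMean ω n - RWRE.averagedMean (RWRE.envMeasure μ) n‖ ^ 2
      ∂(RWRE.envMeasure μ) ≤ C₂ * (n : ℝ) ^ (2 * β) := by
    refine (le_abs_self _).trans (hn.trans ?_)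
    rw [Real.norm_of_nonneg (by positivity)]
    gcongr
    exact le_max_left _ _
  have hfin := RWRE.integral_isEnvLimit_le hd hs hA ht hP n _ fun m =>
    (hvarm n k m hn0 hk0).trans (hk _ hV)
  rw [Real.norm_of_nonneg (MeasureTheory.integral_nonneg fun ω => by positivity),
    Real.norm_of_nonneg (by positivity),
    ← RWRE.integral_quenchedMean_of_isEnvLimit hd hs hA ht hP n]
  refine ((RWRE.integral_norm_sub_integral_sq_le _ (RWRE.integrable_quenchedMean hs hA htP n)
    (RWRE.integrable_quenchedMean_sub_sq hs hA htP n)).trans hfin).trans (le_of_eq ?_)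
  rw [hεe]
  congr 2
  ring
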